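/- Let $\rho>0$ and let $G$ be a real function on $]0,\infty[$ that is completely monotonic (that is, $G$ is $C^\infty$ and $(-1)^n G^{(n)}(t)\ge 0$ for all $t>0$ and $n=0,1,2,\dots$) and locally integrable on $[0,\infty[$, with $G_\infty:=\lim_{t\to\infty}G(t)>0$. For $\operatorname{Re}p>0$ put $\tilde G(p)=\int_0^\infty G(t)\,e^{-pt}\,dt$, $Q(p)=p\,\tilde G(p)$, and $$\kappa(p)=\rho^{1/2}\,p/Q(p)^{1/2},$$ where the square root is the principal one. A Bernstein function is a continuous function $g\ge 0$ on $[0,\infty[$ that is differentiable on $]0,\infty[$ with completely monotonic derivative, and a complete Bernstein function is a function $f:\,]0,\infty[\,\to\mathbb{R}$ of the form $f(x)=x^2\,\tilde g(x)$ with $g$ a Bernstein function. Then: 1. the restriction of $\kappa$ to $]0,\infty[$ is real-valued and is a complete Bernstein function; 2. $\kappa(0)=0$, in the sense that $\kappa(p)\to 0$ as $p\to 0$ with $\operatorname{Re}p>0$; 3. there are a number $B\ge 0$ and a positive Radon measure $\nu$ on $]0,\infty[$, which as a measure on $\mathbb{R}$ not charging $]-\infty,0]$ is still locally finite, with $\int_{]0,\infty[}\frac{\nu(dr)}{1+r}<\infty$,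 such that for all $p\in\mathbb{C}$ with $\operatorname{Re}p>0$ $$\kappa(p)=B\,p+\beta(p),\qquad \beta(p)=p\int_{]0,\infty[}\frac{\nu(dr)}{p+r}.$$ The measure $\nu$ is called the dispersion-attenuation spectral measure. -/

import Mathlib

open Set Filter Topology MeasureTheory
open scoped ContDiff

noncomputable section

namespace Viscoelastic

/-- `f` is completely monotonic on `]0,∞[`: it is smooth there and `(-1)ⁿ Dⁿ f ≥ 0` for all `n`.
Only the values of `f` on the open half-line matter. -/
def IsCompletelyMonotonic (f : ℝ → ℝ) : Prop :=
  ContDiffOn ℝ ∞ f (Ioi 0) ∧ ∀ n : ℕ, ∀ x : ℝ, 0 < x → 0 ≤ (-1 : ℝ) ^ n * iteratedDeriv n f x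

/-- Locally integrable completely monotonic (LICM) functions. Local integrability is meant on the
closed half-line `[0,∞[`, that is, `f` is also integrable near `0`. -/
def IsLICM (f : ℝ → ℝ) : Prop :=
  IsCompletelyMonotonic f ∧ LocallyIntegrableOn f (Ici 0) volume

/-- Bernstein functions on the closed half-line `[0,∞[`: continuous, nonnegative,
differentiable on `]0,∞[` with completely monotonic derivative. -/
def IsBernstein (f : ℝ → ℝ) : Prop :=
  ContinuousOn f (Ici 0) ∧ (∀ x : ℝ, 0 ≤ x → 0 ≤ f x) ∧
    DifferentiableOn ℝ f (Ioi 0) ∧ IsCompletelyMonotonic (deriv f)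

/-- The Laplace transform `f̃(p) = ∫₀^∞ f(t) e^{-pt} dt`. -/
def laplace (f : ℝ → ℝ) (p : ℂ) : ℂ :=
  ∫ t in Ioi (0 : ℝ), (f t : ℂ) * Complex.exp (-p * t)

/-- `f : ]0,∞[ → ℝ` is a complete Bernstein function: `f(x) = x² g̃(x)` for all `x > 0`, for some
Bernstein function `g`. (The Laplace integral of a Bernstein function converges absolutely for
every `x > 0`, since such a function grows at most linearly.) -/
def IsCompleteBernstein (f : ℝ → ℝ) : Prop :=
  ∃ g : ℝ → ℝ, IsBernstein g ∧ ∀ x : ℝ, 0 < x → (f x : ℂ) = (x : ℂ) ^ 2 * laplace g x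

/-- `Q(p) = p G̃(p)`. -/
def complexModulus (G : ℝ → ℝ) (p : ℂ) : ℂ := p * laplace G p

/-- The complex wave number function `κ(p) = ρ^{1/2} p / Q(p)^{1/2}`, with the principal branch of
the square root. -/
def waveNumber (ρ : ℝ) (G : ℝ → ℝ) (p : ℂ) : ℂ :=
  (Real.sqrt ρ : ℂ) * p / complexModulus G p ^ (1 / 2 : ℂ)

/-- Positive Radon measures `ν` on `]0,∞[` (as measures on `ℝ` that do not charge `]-∞,0]`; on `ℝ`
a Radon measure is a locally finite Borel measure) with `∫_{]0,∞[} ν(dr) / (1 + r) < ∞`. -/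
def IsSpectralMeasure (ν : Measure ℝ) : Prop :=
  IsLocallyFiniteMeasure ν ∧ ν (Iic 0) = 0 ∧
    ∫⁻ r in Ioi (0 : ℝ), ENNReal.ofReal (1 / (1 + r)) ∂ν < ⊤

/-- `β(p) = p ∫_{]0,∞[} ν(dr) / (p + r)`. -/
def dispersionAttenuation (ν : Measure ℝ) (p : ℂ) : ℂ :=
  p * ∫ r in Ioi (0 : ℝ), 1 / (p + (r : ℂ)) ∂ν

end Viscoelastic

end

/-! Call a function on Re p > 0 Stieltjes if it is a pointwise limit of nonnegative combinations of
the kernels 1/(p + r), r ≥ 0. Since κ(p) = √ρ · p · Q(p)^{-1/2}, the core of the proof is that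
Q^{-1/2} is Stieltjes and bounded.

The transform of G is Stieltjes because each shift G(a + ·), a > 0, is a limit of exponential sums
with nonnegative coefficients, an approximate form of Bernstein's theorem
(`IsCompletelyMonotonic.exists_tendsto_expSum`, `IsLICM.laplace_mem`). The cone is stable under f ↦
1/(p f) when f has no zeros (`inv_mul_mem`); for finite sums this is the spectral theorem for a
nonnegative symmetric matrix. Hence 1/Q is Stieltjes. This inversion exchanges arithmetic and
harmonic means, so the arithmetic-harmonic iteration started at 1 and 1/Q stays in the cone, and its
limit is Q^{-1/2} (`mem_of_sq_mem`).

Weak compactness represents every Stieltjes function by a finite measure on the compactified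
half-line r ∈ [0, ∞], modelled on [0, 1] (`exists_unitTransform_eq`). The mass at r = ∞ gives B. A
mass at r = 0 would give a term 1/p, excluded by |Q^{-1/2}| ≤ G_∞^{-1/2}; this bound comes from Re Q
≥ G_∞ and also yields κ(0) = 0. Finally x/(x + r) is x² times the Laplace transform of (1 -
e^{-rt})/r, so integrating this kernel against ν produces the Bernstein function behind κ. -/

open scoped NNReal

noncomputable section

namespace Viscoelastic

/-! ### The cone of Stieltjes functions -/

/-- The open right half-plane. -/
abbrev RightHalfPlane : Type := {p : ℂ // 0 < p.re}

/-- The elementary Stieltjes function `p ↦ 1 / (p + r)`. -/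
def stieltjesKernel (r : ℝ≥0) (p : RightHalfPlane) : ℂ := 1 / ((p : ℂ) + (r : ℝ))

/-- The cone of Stieltjes functions on the right half-plane, obtained as the closure, for pointwise
convergence, of the cone generated by the functions `p ↦ 1 / (p + r)` with `r ≥ 0`. -/
def stieltjesCone : Submodule ℝ≥0 (RightHalfPlane → ℂ) :=
  (Submodule.span ℝ≥0 (range stieltjesKernel)).topologicalClosure

lemma RightHalfPlane.add_ofReal_ne_zero (p : RightHalfPlane) {r : ℝ} (hr : 0 ≤ r) :
    (p : ℂ) + (r : ℂ) ≠ 0 := by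
  intro h
  have := congrArg Complex.re h
  have hp := p.2
  simp at this
  linarith

lemma RightHalfPlane.ne_zero (p : RightHalfPlane) : (p : ℂ) ≠ 0 := by
  simpa using p.add_ofReal_ne_zero le_rfl

lemma isClosed_stieltjesCone : IsClosed (stieltjesCone : Set (RightHalfPlane → ℂ)) :=
  Submodule.isClosed_topologicalClosure _

lemma mem_stieltjesCone_iff {f : RightHalfPlane → ℂ} : f ∈ stieltjesCone ↔
    f ∈ closure (Submodule.span ℝ≥0 (range stieltjesKernel) : Set (RightHalfPlane → ℂ)) := Iff.rfl

lemma stieltjesKernel_mem (r : ℝ≥0) : stieltjesKernel r ∈ stieltjesCone :=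
  Submodule.le_topologicalClosure _ (Submodule.subset_span (mem_range_self r))

/-- Constants are the kernels at r = ∞: n/(p + n) tends to 1. -/
lemma const_mem_stieltjesCone (b : ℝ≥0) : (fun _ => ((b : ℝ) : ℂ)) ∈ stieltjesCone := by
  have h1 : (fun _ => (1 : ℂ)) ∈ stieltjesCone := by
    refine isClosed_stieltjesCone.mem_of_tendsto (b := (atTop : Filter ℕ))
      (f := fun n : ℕ => (n : ℝ≥0) • stieltjesKernel n) ?_
      (Eventually.of_forall fun n => stieltjesCone.smul_mem _ (stieltjesKernel_mem _))
    rw [tendsto_pi_nhds]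
    intro p
    have h0 : Tendsto (fun n : ℕ => 1 / ((p : ℂ) * ((n : ℂ))⁻¹ + 1)) atTop (𝓝 (1 / ((p : ℂ) * 0 + 1))) := by
      refine tendsto_const_nhds.div ((tendsto_const_nhds.mul ?_).add_const 1) (by simp)
      exact tendsto_inv_atTop_nhds_zero_nat
    simp only [mul_zero, zero_add, div_one] at h0
    refine h0.congr' ?_
    filter_upwards [eventually_gt_atTop 0] with n hn
    have hn' : (n : ℂ) ≠ 0 := by exact_mod_cast hn.ne'
    have := p.add_ofReal_ne_zero (r := n) (by positivity)
    simp only [Pi.smul_apply, stieltjesKernel, NNReal.smul_def, Complex.real_smul]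
    push_cast at this ⊢
    field_simp
  convert stieltjesCone.smul_mem b h1 using 1
  ext p
  simp [NNReal.smul_def]

/-! ### The inversion f ↦ 1/(p f) -/

/-- `Re (p f(p)) ≥ 0` for Stieltjes functions. -/
lemma re_mul_nonneg_of_mem {f : RightHalfPlane → ℂ} (hf : f ∈ stieltjesCone) (p : RightHalfPlane) :
    0 ≤ ((p : ℂ) * f p).re := by
  have hcl : IsClosed {f : RightHalfPlane → ℂ | 0 ≤ ((p : ℂ) * f p).re} :=
    isClosed_le continuous_const (by fun_prop)
  refine closure_minimal ?_ hcl (mem_stieltjesCone_iff.1 hf)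
  intro u hu
  induction hu using Submodule.span_induction with
  | mem x hx =>
    obtain ⟨r, rfl⟩ := hx
    have h1 := p.add_ofReal_ne_zero r.2
    have hp := p.2
    have hr : (0:ℝ) ≤ r := r.2
    simp only [mem_ofPred_eq, stieltjesKernel, mul_one_div, Complex.div_re]
    rw [← add_div]
    refine div_nonneg ?_ (Complex.normSq_nonneg _)
    simp
    nlinarith [mul_nonneg hp.le hr, sq_nonneg (p : ℂ).re, sq_nonneg (p : ℂ).im]
  | zero => simp
  | add x y _ _ hx hy =>
    simp only [mem_ofPred_eq, Pi.add_apply, mul_add, Complex.add_re] at *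
    linarith
  | smul a x _ hx =>
    simp only [mem_ofPred_eq, Pi.smul_apply, NNReal.smul_def, Complex.real_smul] at *
    rw [mul_left_comm, Complex.re_ofReal_mul]
    exact mul_nonneg a.2 hx

lemma add_mul_ne_zero_of_mem {f : RightHalfPlane → ℂ} (hf : f ∈ stieltjesCone) (p : RightHalfPlane)
    {s : ℝ} (hs : 0 < s) : (s : ℂ) + p * f p ≠ 0 := by
  intro h
  have := congrArg Complex.re h
  have h2 := re_mul_nonneg_of_mem hf p
  simp only [Complex.add_re, Complex.ofReal_re, Complex.zero_re] at this
  linarith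

open scoped InnerProductSpace in
/-- If `f(p) = ∑ mᵢ / (p + rᵢ)`, then `1 / (s + p f(p))` is the inverse of a Schur complement, and
diagonalizing a nonnegative symmetric operator exhibits it as a Stieltjes function. -/
lemma inv_add_mul_sum_mem {n : ℕ} (m r : Fin n → ℝ≥0) {s : ℝ} (hs : 0 < s) :
    (fun p : RightHalfPlane => ((s : ℂ) + p * ∑ i, m i • stieltjesKernel (r i) p)⁻¹)
      ∈ stieltjesCone := by
  set f : RightHalfPlane → ℂ := fun p => ∑ i, m i • stieltjesKernel (r i) p with hfdef
  have hf : f ∈ stieltjesCone := by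
    have : f = ∑ i, m i • stieltjesKernel (r i) := by ext p; simp [hfdef]
    rw [this]
    exact Submodule.sum_mem _ fun i _ => stieltjesCone.smul_mem _ (stieltjesKernel_mem _)
  -- Since p m/(p + r) = m - m r/(p + r), one has s + p f(p) = a - ⟨b, (p + R)⁻¹ b⟩ with bᵢ = √(mᵢ
  -- rᵢ) and R = diag(rᵢ): the Schur complement of p + R in a bordered matrix. Eliminating the
  -- corner a instead leaves p + T with T = R - a⁻¹ b b*.
  set a : ℝ := s + ∑ i, (m i : ℝ) with ha
  have hm0 : (0:ℝ) ≤ ∑ i, (m i : ℝ) := Finset.sum_nonneg fun i _ => (m i).2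
  have ha0 : 0 < a := by linarith
  have haC : (a : ℂ) ≠ 0 := by exact_mod_cast ha0.ne'
  let b  : EuclideanSpace ℂ (Fin n) := WithLp.toLp 2 fun i => ((Real.sqrt (m i * r i) : ℝ) : ℂ)
  let R : EuclideanSpace ℂ (Fin n) →ₗ[ℂ] EuclideanSpace ℂ (Fin n) := 
    { toFun := fun x => WithLp.toLp 2 fun i => ((r i : ℝ) : ℂ) * x i
      map_add' := fun x y => by ext i; simp [mul_add]
      map_smul' := fun c x => by ext i; simp [mul_left_comm] }
  have hRapp : ∀ x i, R x i = ((r i : ℝ) : ℂ) * x i := fun _ _ => rfl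
  let T : EuclideanSpace ℂ (Fin n) →ₗ[ℂ] EuclideanSpace ℂ (Fin n) := R - ((a : ℂ)⁻¹) • ((innerSL ℂ b).toLinearMap.smulRight b)
  have hTapp : ∀ x, T x = R x - ((a : ℂ)⁻¹ * ⟪b, x⟫_ℂ) • b := fun x => by
    simp [T, smul_smul]
  have hT : T.IsSymmetric := by
    intro x y
    have hR : ⟪R x, y⟫_ℂ = ⟪x, R y⟫_ℂ := by
      simp only [PiLp.inner_apply, hRapp]
      refine Finset.sum_congr rfl fun i _ => ?_
      simp [inner]
      ring
    simp only [hTapp, inner_sub_left, inner_sub_right, hR, inner_smul_left, inner_smul_right]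
    congr 1
    simp only [map_mul, map_inv₀, Complex.conj_ofReal, inner_conj_symm]
    ring
  have hfin : Module.finrank ℂ (EuclideanSpace ℂ (Fin n)) = n := by simp
  let u := hT.eigenvectorBasis hfin
  let lam := hT.eigenvalues hfin
  have hpos : ∀ x, 0 ≤ (⟪x, T x⟫_ℂ).re := by
    intro x
    have h1 : (⟪x, R x⟫_ℂ).re = ∑ i, (r i : ℝ) * ‖x i‖ ^ 2 := by
      simp only [PiLp.inner_apply, hRapp, Complex.re_sum]
      refine Finset.sum_congr rfl fun i _ => ?_
      simp only [RCLike.inner_apply, mul_assoc]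
      rw [Complex.re_ofReal_mul, Complex.mul_conj, Complex.normSq_eq_norm_sq, Complex.ofReal_re]
    have h2 : ‖⟪b, x⟫_ℂ‖ ≤ ∑ i, Real.sqrt (m i) * (Real.sqrt (r i) * ‖x i‖) := by
      rw [PiLp.inner_apply]
      refine (norm_sum_le _ _).trans (Finset.sum_le_sum fun i _ => ?_)
      simp only [b, RCLike.inner_apply, norm_mul, Complex.conj_ofReal, Complex.norm_real]
      rw [Real.sqrt_mul (NNReal.coe_nonneg _), Real.norm_of_nonneg (by positivity)]
      apply le_of_eq; ring
    -- Cauchy-Schwarz together with ∑ mᵢ ≤ a makes T nonnegative, so that its eigenvalues are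
    -- admissible poles.
    have h3 : ‖⟪b, x⟫_ℂ‖ ^ 2 ≤ a * ∑ i, (r i : ℝ) * ‖x i‖ ^ 2 := by
      calc ‖⟪b, x⟫_ℂ‖ ^ 2 ≤ (∑ i, Real.sqrt (m i) * (Real.sqrt (r i) * ‖x i‖)) ^ 2 := by gcongr
        _ ≤ (∑ i, Real.sqrt (m i) ^ 2) * ∑ i, (Real.sqrt (r i) * ‖x i‖) ^ 2 :=
          Finset.sum_mul_sq_le_sq_mul_sq _ _ _
        _ = (∑ i, (m i : ℝ)) * ∑ i, (r i : ℝ) * ‖x i‖ ^ 2 := by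
          simp [mul_pow, Real.sq_sqrt]
        _ ≤ _ := by
          refine mul_le_mul_of_nonneg_right (by linarith) (Finset.sum_nonneg fun i _ => by positivity)
    have h4 : (⟪x, T x⟫_ℂ).re = (∑ i, (r i : ℝ) * ‖x i‖ ^ 2) - a⁻¹ * ‖⟪b, x⟫_ℂ‖ ^ 2 := by
      rw [hTapp, inner_sub_right, Complex.sub_re, h1, inner_smul_right, mul_assoc,
        ← inner_conj_symm x b, Complex.mul_conj, Complex.normSq_eq_norm_sq, ← Complex.ofReal_inv,
        Complex.re_ofReal_mul, Complex.ofReal_re]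
    rw [h4, sub_nonneg, inv_mul_le_iff₀ ha0]
    exact h3
  have hlam : ∀ j, 0 ≤ lam j := by
    intro j
    have h := hpos (u j)
    rw [show T (u j) = ((lam j : ℝ) : ℂ) • u j from hT.apply_eigenvectorBasis hfin j,
      inner_smul_right, inner_self_eq_norm_sq_to_K, u.orthonormal.1 j] at h
    simpa using h
  -- The Woodbury identity D⁻¹ = a⁻¹ + a⁻² ⟨b, (p + T)⁻¹ b⟩, expanded in an eigenbasis of T. It is
  -- obtained below from y = (p + R)⁻¹ b, which satisfies (p + T) y = (D/a) b.
  have key : (fun p : RightHalfPlane => ((s : ℂ) + p * f p)⁻¹) =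
      (fun _ => (((Real.toNNReal a⁻¹) : ℝ) : ℂ)) +
        ∑ j, (Real.toNNReal ((a⁻¹) ^ 2 * ‖⟪u j, b⟫_ℂ‖ ^ 2)) •
          stieltjesKernel (Real.toNNReal (lam j)) := by
    funext p
    set D : ℂ := (s : ℂ) + p * f p with hD
    have hD0 : D ≠ 0 := add_mul_ne_zero_of_mem hf p hs
    let y  : EuclideanSpace ℂ (Fin n) := WithLp.toLp 2 fun i => b i / ((p : ℂ) + (r i : ℝ))
    have hby : ⟪b, y⟫_ℂ = a - D := by
      have : ∀ i, ⟪b i, y i⟫_ℂ = (m i : ℝ) - p * ((m i : ℝ) * (1 / ((p : ℂ) + (r i : ℝ)))) := by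
        intro i
        have h0 := p.add_ofReal_ne_zero (NNReal.coe_nonneg (r i))
        have hsq : ((Real.sqrt (m i * r i) : ℝ) : ℂ) * ((Real.sqrt (m i * r i) : ℝ) : ℂ)
            = (m i : ℝ) * (r i : ℝ) := by
          rw [← Complex.ofReal_mul, Real.mul_self_sqrt (by positivity)]; push_cast; rfl
        simp only [y, b, RCLike.inner_apply, Complex.conj_ofReal]
        rw [div_mul_eq_mul_div, hsq]
        rw [eq_sub_iff_add_eq, mul_one_div, mul_div_assoc', ← add_div, div_eq_iff h0]
        ring
      rw [PiLp.inner_apply, Finset.sum_congr rfl fun i _ => this i, Finset.sum_sub_distrib, hD, ha,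
        ← Finset.mul_sum]
      simp only [hfdef, stieltjesKernel, NNReal.smul_def, Complex.real_smul]
      push_cast
      ring
    have hTy : (p : ℂ) • y + T y = (D / a) • b := by
      have hR : (p : ℂ) • y + R y = b := by
        ext i
        have h0 := p.add_ofReal_ne_zero (NNReal.coe_nonneg (r i))
        simp only [PiLp.add_apply, PiLp.smul_apply, hRapp, y, smul_eq_mul]
        field_simp
      rw [hTapp, ← add_sub_assoc, hR, hby, ← one_smul ℂ b, smul_smul, ← sub_smul, smul_smul]
      congr 1
      field_simp
      ring
    have hco : ∀ j, ⟪u j, y⟫_ℂ = (D / a) * ⟪u j, b⟫_ℂ / (p + (lam j : ℝ)) := by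
      intro j
      have h0 := p.add_ofReal_ne_zero (hlam j)
      have h1 := congrArg (fun z => ⟪u j, z⟫_ℂ) hTy
      simp only [inner_add_right, inner_smul_right] at h1
      rw [← hT (u j) y, show T (u j) = ((lam j : ℝ) : ℂ) • u j from hT.apply_eigenvectorBasis hfin j,
        inner_smul_left, Complex.conj_ofReal, ← add_mul] at h1
      rw [eq_div_iff h0, ← h1, mul_comm]
    have hsum : (a : ℂ) - D = (D / a) * ∑ j, ((‖⟪u j, b⟫_ℂ‖ ^ 2 : ℝ) : ℂ) * (1 / (p + (lam j : ℝ))) := by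
      rw [← hby, ← u.sum_inner_mul_inner b y, Finset.mul_sum]
      refine Finset.sum_congr rfl fun j _ => ?_
      rw [hco, ← Complex.normSq_eq_norm_sq, ← Complex.mul_conj, inner_conj_symm]
      ring
    simp only [Pi.add_apply, Finset.sum_apply, Pi.smul_apply, stieltjesKernel, NNReal.smul_def,
      Complex.real_smul, Real.coe_toNNReal _ (hlam _), Real.coe_toNNReal _ (inv_pos.2 ha0).le]
    have h5 : ∀ j, (((a⁻¹) ^ 2 * ‖⟪u j, b⟫_ℂ‖ ^ 2 : ℝ) : ℂ) * (1 / (p + (lam j : ℝ))) =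
        ((a : ℂ)⁻¹) ^ 2 * (((‖⟪u j, b⟫_ℂ‖ ^ 2 : ℝ) : ℂ) * (1 / (p + (lam j : ℝ)))) := by
      intro j; push_cast; ring
    have h7 : ∀ j, ((a⁻¹) ^ 2 * ‖⟪u j, b⟫_ℂ‖ ^ 2).toNNReal = (a⁻¹) ^ 2 * ‖⟪u j, b⟫_ℂ‖ ^ 2 := fun j =>
      Real.coe_toNNReal _ (by positivity)
    simp only [h7]
    rw [Finset.sum_congr rfl fun j _ => h5 j, ← Finset.mul_sum]
    have h6 : ∑ j, ((‖⟪u j, b⟫_ℂ‖ ^ 2 : ℝ) : ℂ) * (1 / (p + (lam j : ℝ))) = ((a : ℂ) - D) * a / D := by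
      rw [hsum]; field_simp
    rw [h6]
    push_cast
    field_simp
    ring
  rw [key]
  exact add_mem (const_mem_stieltjesCone _)
    (Submodule.sum_mem _ fun j _ => stieltjesCone.smul_mem _ (stieltjesKernel_mem _))

/-- Since Re(p f) ≥ 0 on the whole closed cone, s > 0 keeps the denominator away from zero; the map
is then continuous for pointwise convergence and passes from finite sums to limits. -/
lemma inv_add_mul_mem {f : RightHalfPlane → ℂ} (hf : f ∈ stieltjesCone) {s : ℝ} (hs : 0 < s) :
    (fun p : RightHalfPlane => ((s : ℂ) + p * f p)⁻¹) ∈ stieltjesCone := by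
  have hmaps : MapsTo (fun (f : RightHalfPlane → ℂ) (p : RightHalfPlane) => ((s : ℂ) + p * f p)⁻¹)
      (Submodule.span ℝ≥0 (range stieltjesKernel) : Set _) (stieltjesCone : Set _) := by
    intro u hu
    obtain ⟨n, m, g, rfl⟩ := Submodule.mem_span_set'.1 hu
    choose r hr using fun i => (g i).2
    have := inv_add_mul_sum_mem m r hs
    simpa [← hr] using this
  have hcont : ContinuousOn
      (fun (f : RightHalfPlane → ℂ) (p : RightHalfPlane) => ((s : ℂ) + p * f p)⁻¹)
      (closure (Submodule.span ℝ≥0 (range stieltjesKernel) : Set _)) := by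
    refine continuousOn_pi.2 fun p => ?_
    refine ContinuousOn.inv₀ (by fun_prop) fun u hu => add_mul_ne_zero_of_mem hu p hs
  have := hmaps.closure_of_continuousOn hcont hf
  rwa [isClosed_stieltjesCone.closure_eq] at this

lemma inv_mul_mem {f : RightHalfPlane → ℂ} (hf : f ∈ stieltjesCone) (h0 : ∀ p, f p ≠ 0) :
    (fun p : RightHalfPlane => ((p : ℂ) * f p)⁻¹) ∈ stieltjesCone := by
  refine isClosed_stieltjesCone.mem_of_tendsto (b := 𝓝[>] (0:ℝ))
    (f := fun (s : ℝ) p => ((s : ℂ) + p * f p)⁻¹) ?_ ?_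
  · rw [tendsto_pi_nhds]
    intro p
    have hne : (p : ℂ) * f p ≠ 0 := mul_ne_zero p.ne_zero (h0 p)
    have : Tendsto (fun s : ℝ => ((s : ℂ) + p * f p)) (𝓝[>] 0) (𝓝 (((0 : ℝ) : ℂ) + p * f p)) :=
      ((Complex.continuous_ofReal.tendsto 0).mono_left nhdsWithin_le_nhds).add_const _
    simp only [Complex.ofReal_zero, zero_add] at this
    exact this.inv₀ hne
  · filter_upwards [self_mem_nhdsWithin] with s hs using inv_add_mul_mem hf hs

/-! ### Means and square roots -/

lemma half_smul_add_mem {a b : RightHalfPlane → ℂ} (ha : a ∈ stieltjesCone)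
    (hb : b ∈ stieltjesCone) : (fun p => (a p + b p) / 2) ∈ stieltjesCone := by
  convert stieltjesCone.smul_mem (2⁻¹ : ℝ≥0) (add_mem ha hb) using 1
  ext p
  simp [NNReal.smul_def]
  ring

/-- Conjugating the arithmetic mean by the involution f ↦ 1/(p f) gives the harmonic mean. -/
lemma harmonic_mean_mem {a b : RightHalfPlane → ℂ} (ha : a ∈ stieltjesCone)
    (hb : b ∈ stieltjesCone) (ha0 : ∀ p, a p ≠ 0) (hb0 : ∀ p, b p ≠ 0)
    (hab : ∀ p, a p + b p ≠ 0) : (fun p => 2 * a p * b p / (a p + b p)) ∈ stieltjesCone := by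
  have h := inv_mul_mem (half_smul_add_mem (inv_mul_mem ha ha0) (inv_mul_mem hb hb0)) ?_
  · convert h using 2 with p
    have h1 := p.ne_zero; have h2 := ha0 p; have h3 := hb0 p; have h4 := hab p
    have h5 : b p + a p ≠ 0 := by rwa [add_comm]
    field_simp
    simp [add_comm]
  · intro p
    have h1 := p.ne_zero; have h2 := ha0 p; have h3 := hb0 p; have h4 := hab p
    have : (((p : ℂ) * a p)⁻¹ + ((p : ℂ) * b p)⁻¹) / 2 = (a p + b p) / (2 * p * a p * b p) := by
      field_simp
      ring
    rw [this]
    exact div_ne_zero h4 (mul_ne_zero (mul_ne_zero (mul_ne_zero two_ne_zero h1) h2) h3)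

/-- The Stieltjes cone is closed under square roots: the arithmetic-harmonic mean iteration
started at `1` and `z ^ 2` stays in the cone and converges to `z`. -/
lemma mem_of_sq_mem {z : RightHalfPlane → ℂ} (hz : ∀ p, 0 < (z p).re)
    (h : (fun p => z p ^ 2) ∈ stieltjesCone) : z ∈ stieltjesCone := by
  -- The Cayley transform sends Re z > 0 into the unit disc and linearizes the iteration: each step
  -- squares w.
  set w : RightHalfPlane → ℂ := fun p => (1 - z p) / (1 + z p) with hw
  have hz1 : ∀ p, 1 + z p ≠ 0 := fun p h0 => by
    have := congrArg Complex.re h0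
    have := hz p
    simp at *
    linarith
  have hz0 : ∀ p, z p ≠ 0 := fun p h0 => by have := hz p; simp [h0] at this
  have hw1 : ∀ p, ‖w p‖ < 1 := by
    intro p
    rw [hw, norm_div, div_lt_one (norm_pos_iff.2 (hz1 p))]
    refine lt_of_pow_lt_pow_left₀ 2 (norm_nonneg _) ?_
    rw [← Complex.normSq_eq_norm_sq, ← Complex.normSq_eq_norm_sq, Complex.normSq_apply,
      Complex.normSq_apply]
    have := hz p
    simp
    nlinarith
  have hWlt : ∀ p (n : ℕ), ‖w p ^ 2 ^ n‖ < 1 := fun p n => by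
    rw [norm_pow]; exact pow_lt_one₀ (norm_nonneg _) (hw1 p) (by positivity)
  have hsub : ∀ W : ℂ, ‖W‖ < 1 → 1 - W ≠ 0 := fun W hW h0 => by
    rw [← sub_eq_zero.1 h0] at hW; simp at hW
  have hadd : ∀ W : ℂ, ‖W‖ < 1 → 1 + W ≠ 0 := fun W hW h0 => by
    have := hsub (-W) (by simpa using hW); rw [sub_neg_eq_add] at this; exact this h0
  -- Closed form of the two iterates. Their product is always z², and w = (1 - z)/(1 + z) makes them
  -- 1 and z² at n = 0.
  have main : ∀ n : ℕ,
      (fun p => z p * (1 + w p ^ 2 ^ n) / (1 - w p ^ 2 ^ n)) ∈ stieltjesCone ∧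
      (fun p => z p * (1 - w p ^ 2 ^ n) / (1 + w p ^ 2 ^ n)) ∈ stieltjesCone := by
    intro n
    induction n with
    | zero =>
      constructor
      · convert const_mem_stieltjesCone 1 using 2 with p
        have h1 := hsub _ (hw1 p)
        have h2 := hz1 p; have h3 := hz0 p
        simp only [pow_zero, pow_one, NNReal.coe_one, Complex.ofReal_one]
        rw [div_eq_one_iff_eq h1]
        simp only [hw]
        field_simp
        ring
      · convert h using 2 with p
        have h1 := hadd _ (hw1 p)
        have h2 := hz1 p
        simp only [pow_zero, pow_one]
        rw [div_eq_iff h1]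
        simp only [hw]
        field_simp
        ring
    | succ n ih =>
      have hsq : ∀ p, w p ^ 2 ^ (n + 1) = (w p ^ 2 ^ n) ^ 2 := fun p => by rw [pow_succ, pow_mul]
      have hA : ∀ p, (1:ℂ) + (w p ^ 2 ^ n) ^ 2 ≠ 0 := fun p => by
        rw [← hsq]; exact hadd _ (hWlt p _)
      have hS : ∀ p, (1:ℂ) - (w p ^ 2 ^ n) ^ 2 ≠ 0 := fun p => by
        rw [← hsq]; exact hsub _ (hWlt p _)
      have hsum : ∀ p, z p * (1 + w p ^ 2 ^ n) / (1 - w p ^ 2 ^ n) +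
          z p * (1 - w p ^ 2 ^ n) / (1 + w p ^ 2 ^ n) =
            2 * (z p * (1 + (w p ^ 2 ^ n) ^ 2) / (1 - (w p ^ 2 ^ n) ^ 2)) := by
        intro p
        have h1 := hsub _ (hWlt p n); have h2 := hadd _ (hWlt p n); have h4 := hS p
        rw [show (1:ℂ) - (w p ^ 2 ^ n) ^ 2 = (1 - w p ^ 2 ^ n) * (1 + w p ^ 2 ^ n) by ring] at *
        field_simp
        ring
      constructor
      · convert half_smul_add_mem ih.1 ih.2 using 2 with p
        rw [hsum, hsq]
        ring
      · have hh := harmonic_mean_mem ih.1 ih.2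
          (fun p => div_ne_zero (mul_ne_zero (hz0 p) (hadd _ (hWlt p n))) (hsub _ (hWlt p n)))
          (fun p => div_ne_zero (mul_ne_zero (hz0 p) (hsub _ (hWlt p n))) (hadd _ (hWlt p n)))
          (fun p => by
            rw [hsum]
            exact mul_ne_zero two_ne_zero (div_ne_zero (mul_ne_zero (hz0 p) (hA p)) (hS p)))
        convert hh using 2 with p
        rw [hsum, hsq]
        have h1 := hsub _ (hWlt p n); have h2 := hadd _ (hWlt p n); have h3 := hA p
        have h4 := hS p; have h5 := hz0 p
        field_simp
  refine isClosed_stieltjesCone.mem_of_tendsto (b := (atTop : Filter ℕ)) ?_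
    (Eventually.of_forall fun n => (main n).1)
  rw [tendsto_pi_nhds]
  intro p
  have hW : Tendsto (fun n : ℕ => w p ^ 2 ^ n) atTop (𝓝 0) :=
    (tendsto_pow_atTop_nhds_zero_of_norm_lt_one (hw1 p)).comp
      (tendsto_pow_atTop_atTop_of_one_lt (one_lt_two (α := ℕ)))
  have := ((hW.const_add 1).const_mul (z p)).div (hW.const_sub 1) (by simp)
  simpa [Pi.div_def] using this

/-! ### Completely monotonic functions -/

namespace IsCompletelyMonotonic

variable {f : ℝ → ℝ}

lemma contDiffAt (hf : IsCompletelyMonotonic f) {x : ℝ} (hx : 0 < x) : ContDiffAt ℝ ∞ f x :=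
  hf.1.contDiffAt (Ioi_mem_nhds hx)

lemma nonneg (hf : IsCompletelyMonotonic f) {x : ℝ} (hx : 0 < x) : 0 ≤ f x := by
  simpa using hf.2 0 x hx

lemma differentiableAt_iteratedDeriv (hf : IsCompletelyMonotonic f) (n : ℕ) {x : ℝ} (hx : 0 < x) :
    DifferentiableAt ℝ (iteratedDeriv n f) x := by
  rw [iteratedDeriv_eq_equiv_comp, LinearIsometryEquiv.comp_differentiableAt_iff]
  exact (hf.contDiffAt hx).differentiableAt_iteratedFDeriv
    (by exact_mod_cast ENat.natCast_lt_top n)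

lemma antitoneOn_iteratedDeriv (hf : IsCompletelyMonotonic f) (n : ℕ) :
    AntitoneOn (fun x => (-1 : ℝ) ^ n * iteratedDeriv n f x) (Ioi 0) := by
  have hd : ∀ x ∈ Ioi (0:ℝ), DifferentiableAt ℝ (fun x => (-1 : ℝ) ^ n * iteratedDeriv n f x) x :=
    fun x hx => (hf.differentiableAt_iteratedDeriv n hx).const_mul _
  refine antitoneOn_of_deriv_nonpos (convex_Ioi 0)
    (fun x hx => (hd x hx).continuousAt.continuousWithinAt) ?_ ?_
  · rw [interior_Ioi]
    exact fun x hx => (hd x hx).differentiableWithinAt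
  · rw [interior_Ioi]
    intro x hx
    rw [deriv_const_mul _ (hf.differentiableAt_iteratedDeriv n hx), ← iteratedDeriv_succ]
    have := hf.2 (n + 1) x hx
    rw [pow_succ] at this
    linarith

lemma antitoneOn (hf : IsCompletelyMonotonic f) : AntitoneOn f (Ioi 0) := by
  simpa using hf.antitoneOn_iteratedDeriv 0

/-- Each signed derivative is antitone, so its decrement is nonnegative. Iterating makes all finite
differences nonnegative; these are the weights of the exponential sums. -/
lemma sub_shift (hf : IsCompletelyMonotonic f) {h : ℝ} (hh : 0 < h) :
    IsCompletelyMonotonic (fun x => f x - f (x + h)) := by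
  have hs : ∀ x, 0 < x → ContDiffAt ℝ ∞ (fun x => f (x + h)) x := fun x hx =>
    ContDiffAt.comp x (hf.contDiffAt (by positivity : 0 < x + h)) (by fun_prop)
  refine ⟨fun x hx => ((hf.contDiffAt hx).sub (hs x hx)).contDiffWithinAt, fun n x hx => ?_⟩
  have h1 : iteratedDeriv n (fun x => f x - f (x + h)) x
      = iteratedDeriv n f x - iteratedDeriv n f (x + h) := by
    have := iteratedDeriv_fun_sub (n := n) ((hf.contDiffAt hx).of_le (by exact_mod_cast le_top))
      ((hs x hx).of_le (by exact_mod_cast le_top))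
    rw [this, iteratedDeriv_comp_add_const]
  rw [h1, mul_sub, sub_nonneg]
  exact hf.antitoneOn_iteratedDeriv n hx (by simp; positivity) (by linarith)

lemma sub_const (hf : IsCompletelyMonotonic f) {c : ℝ} (hc : ∀ x, 0 < x → c ≤ f x) :
    IsCompletelyMonotonic (fun x => f x - c) := by
  refine ⟨hf.1.sub contDiffOn_const, fun n x hx => ?_⟩
  rcases n with _ | n
  · simpa using hc x hx
  · have h1 : deriv (fun x => f x - c) = deriv f := by ext y; simp
    rw [iteratedDeriv_succ', h1, ← iteratedDeriv_succ']
    exact hf.2 _ x hx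

end IsCompletelyMonotonic

/-! ### Approximation by exponential sums -/

/-- The shift operator `f ↦ f (· + h)`. -/
def shiftEnd (h : ℝ) : Module.End ℝ (ℝ → ℝ) := LinearMap.funLeft ℝ ℝ (· + h)

lemma shiftEnd_apply (h : ℝ) (f : ℝ → ℝ) (x : ℝ) : shiftEnd h f x = f (x + h) := rfl

lemma shiftEnd_pow_apply (h : ℝ) (f : ℝ → ℝ) (k : ℕ) (x : ℝ) :
    (shiftEnd h ^ k) f x = f (x + k * h) := by
  induction k generalizing x with
  | zero => simp
  | succ k ih =>
    rw [pow_succ', Module.End.mul_apply, shiftEnd_apply, ih]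
    push_cast
    ring_nf

lemma IsCompletelyMonotonic.one_sub_shiftEnd_pow {f : ℝ → ℝ} (hf : IsCompletelyMonotonic f) {h : ℝ}
    (hh : 0 < h) (k : ℕ) : IsCompletelyMonotonic (((1 - shiftEnd h) ^ k) f) := by
  induction k with
  | zero => simpa using hf
  | succ k ih =>
    rw [pow_succ', Module.End.mul_apply]
    exact ih.sub_shift hh

/-- The binomial expansion of 1 = (S + (1 - S))^M for the shift S, applied to f. -/
lemma eq_sum_choose_mul_one_sub_shiftEnd_pow (f : ℝ → ℝ) (h x : ℝ) (M : ℕ) :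
    f x = ∑ j ∈ Finset.range (M + 1),
      (M.choose j : ℝ) * ((1 - shiftEnd h) ^ (M - j)) f (x + j * h) := by
  have hc : Commute (shiftEnd h) (1 - shiftEnd h) := by
    rw [commute_iff_eq]; noncomm_ring
  have h1 : (1 : Module.End ℝ (ℝ → ℝ)) = ∑ j ∈ Finset.range (M + 1),
      shiftEnd h ^ j * (1 - shiftEnd h) ^ (M - j) * (M.choose j : Module.End ℝ (ℝ → ℝ)) := by
    rw [← hc.add_pow, add_sub_cancel, one_pow]
  have h2 := congrFun (congrArg (fun T : Module.End ℝ (ℝ → ℝ) => T f) h1) x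
  simp only [Module.End.one_apply, LinearMap.sum_apply, Finset.sum_apply] at h2
  rw [h2]
  refine Finset.sum_congr rfl fun j _ => ?_
  rw [← Nat.cast_comm, ← nsmul_eq_mul, LinearMap.smul_apply, Pi.smul_apply, Module.End.mul_apply,
    shiftEnd_pow_apply, nsmul_eq_mul]

/-- The quotient is the product of the factors (k - i)/(N - i), i < n, each within i/N of k/N. All
factors lie in [0, 1], so the errors add up. For k < n truncated subtraction agrees with the
vanishing of the falling factorial. -/
lemma abs_descFactorial_div_sub_pow_le {k N : ℕ} (hk : k ≤ N) (n : ℕ) (hn : n ≤ N) :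
    |(k.descFactorial n : ℝ) / N.descFactorial n - ((k : ℝ) / N) ^ n| ≤ (n : ℝ) ^ 2 / N := by
  induction n with
  | zero => simp
  | succ n ih =>
    have hN : (0:ℝ) < N := by exact_mod_cast (by omega : 0 < N)
    have hNn : (0:ℝ) < ((N - n : ℕ) : ℝ) := by exact_mod_cast (by omega : 0 < N - n)
    set w : ℝ := (k.descFactorial n : ℝ) / N.descFactorial n with hw
    set x : ℝ := (k : ℝ) / N with hx
    set q : ℝ := ((k - n : ℕ) : ℝ) / ((N - n : ℕ) : ℝ) with hq
    have hx0 : 0 ≤ x := by positivity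
    have hx1 : x ≤ 1 := by rw [hx, div_le_one hN]; exact_mod_cast hk
    have hw0 : 0 ≤ w := by positivity
    have hw1 : w ≤ 1 := by
      refine div_le_one_of_le₀ ?_ (by positivity)
      exact_mod_cast Nat.descFactorial_le n hk
    have hqx : |q - x| ≤ n / N := by
      rcases le_total n k with h | h
      · have h1 : q - x = - (n * ((N : ℝ) - k) / (N * ((N - n : ℕ) : ℝ))) := by
          rw [hq, hx, div_sub_div _ _ hNn.ne' hN.ne', ← neg_div,
            div_eq_div_iff (by positivity) (by positivity), Nat.cast_sub h,
            Nat.cast_sub (by omega : n ≤ N)]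
          ring
        have hkN : (0:ℝ) ≤ (N : ℝ) - k := by rw [sub_nonneg]; exact_mod_cast hk
        rw [h1, abs_neg, abs_of_nonneg (by positivity), div_le_div_iff₀ (by positivity) hN,
          Nat.cast_sub (by omega : n ≤ N)]
        have : (N : ℝ) - k ≤ N - n := by
          have : (n:ℝ) ≤ k := by exact_mod_cast h
          linarith
        have h2 : (n : ℝ) * (N * (N - k)) ≤ n * (N * (N - n)) := by gcongr
        linarith
      · rw [hq, Nat.sub_eq_zero_of_le h]
        simp only [Nat.cast_zero, zero_div, zero_sub, abs_neg]
        rw [abs_of_nonneg hx0, hx]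
        exact div_le_div_of_nonneg_right (by exact_mod_cast h) hN.le
    have ih' := ih (by omega)
    have h3 : (k.descFactorial (n + 1) : ℝ) / N.descFactorial (n + 1) = q * w := by
      rw [Nat.descFactorial_succ, Nat.descFactorial_succ, Nat.cast_mul, Nat.cast_mul,
        mul_div_mul_comm]
    rw [h3, pow_succ]
    calc |q * w - x ^ n * x| = |(q - x) * w + x * (w - x ^ n)| := by ring_nf
      _ ≤ |q - x| * w + x * |w - x ^ n| := by
        refine (abs_add_le _ _).trans ?_
        rw [abs_mul, abs_mul, abs_of_nonneg hw0, abs_of_nonneg hx0]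
      _ ≤ n / N * 1 + 1 * ((n : ℝ) ^ 2 / N) := by gcongr
      _ ≤ ((n + 1 : ℕ) : ℝ) ^ 2 / N := by
        rw [mul_one, one_mul, ← add_div]
        gcongr
        push_cast
        nlinarith [(Nat.cast_nonneg n : (0:ℝ) ≤ n)]

/-- `∑ cᵢ e^{-rᵢ t}`. -/
def expSum {K : ℕ} (c r : Fin K → ℝ≥0) (t : ℝ) : ℝ := ∑ i, (c i : ℝ) * Real.exp (-(r i : ℝ) * t)

lemma expSum_antitone {K : ℕ} (c r : Fin K → ℝ≥0) : Antitone (expSum c r) := by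
  intro s t hst
  refine Finset.sum_le_sum fun i _ => ?_
  refine mul_le_mul_of_nonneg_left (Real.exp_le_exp.2 ?_) (NNReal.coe_nonneg _)
  linarith [mul_le_mul_of_nonneg_left hst (NNReal.coe_nonneg (r i))]

lemma expSum_nonneg {K : ℕ} (c r : Fin K → ℝ≥0) (t : ℝ) : 0 ≤ expSum c r t :=
  Finset.sum_nonneg fun i _ => by positivity

/-- A completely monotonic function is approximated on a grid by exponential sums with nonnegative
coefficients, by the Hausdorff moment construction with Bernstein polynomials. -/
lemma IsCompletelyMonotonic.exists_expSum {f : ℝ → ℝ} (hf : IsCompletelyMonotonic f) {a h : ℝ}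
    (ha : 0 < a) (hh : 0 < h) {N : ℕ} (hN : 0 < N) :
    ∃ c r : Fin N → ℝ≥0, expSum c r 0 ≤ f a ∧ ∀ n : ℕ, 1 ≤ n → n ≤ N →
      |f (a + n * h) - expSum c r (n * h)| ≤ f a * ((n : ℝ) ^ 2 / N) := by
  -- The Hausdorff masses, placed at the points k/N of [0, 1].
  set lam : ℕ → ℝ := fun k => (N.choose k : ℝ) * ((1 - shiftEnd h) ^ (N - k)) f (a + k * h) with hlam
  have hlam0 : ∀ k, 0 ≤ lam k := fun k =>
    mul_nonneg (by positivity) ((hf.one_sub_shiftEnd_pow hh _).nonneg (by positivity))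
  have hNR : (0:ℝ) < N := by exact_mod_cast hN
  have hsum : ∑ k ∈ Finset.range (N + 1), lam k = f a :=
    (eq_sum_choose_mul_one_sub_shiftEnd_pow f h a N).symm
  -- Expand f(a + n h) to order N - n and reindex by k = n + j: the values of f on the grid are
  -- moments of `lam`, with falling factorials in place of powers.
  have hmom : ∀ n ≤ N, f (a + n * h) = ∑ k ∈ Finset.range (N + 1),
      lam k * ((k.descFactorial n : ℝ) / N.descFactorial n) := by
    intro n hn
    have hz : ∑ k ∈ Finset.range n, lam k * ((k.descFactorial n : ℝ) / N.descFactorial n) = 0 :=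
      Finset.sum_eq_zero fun k hk => by
        rw [Nat.descFactorial_of_lt (Finset.mem_range.1 hk)]; simp
    rw [eq_sum_choose_mul_one_sub_shiftEnd_pow f h (a + n * h) (N - n),
      show N + 1 = n + (N - n + 1) by omega, Finset.sum_range_add _ n, hz, zero_add]
    refine Finset.sum_congr rfl fun j hj => ?_
    have hj' : j ≤ N - n := by have := Finset.mem_range.1 hj; omega
    have hch : (N.choose (n + j) : ℝ) * ((n + j).descFactorial n) =
        (N.descFactorial n) * ((N - n).choose j) := by
      have := Nat.choose_mul (n := N) (k := n + j) (s := n) (by omega)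
      rw [Nat.add_sub_cancel_left] at this
      rw [Nat.descFactorial_eq_factorial_mul_choose, Nat.descFactorial_eq_factorial_mul_choose]
      have h2 : (N.choose (n + j) : ℝ) * ((n + j).choose n) = N.choose n * (N - n).choose j := by
        exact_mod_cast this
      push_cast
      linear_combination (n.factorial : ℝ) * h2
    have hd : (N.descFactorial n : ℝ) ≠ 0 := by
      exact_mod_cast (Nat.descFactorial_pos.2 hn).ne'
    have hpt : a + n * h + j * h = a + ((n + j : ℕ) : ℝ) * h := by push_cast; ring
    simp only [hlam]
    rw [hpt, show N - n - j = N - (n + j) by omega, mul_div_assoc', eq_div_iff hd]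
    linear_combination (-((1 - shiftEnd h) ^ (N - (n + j))) f (a + ((n + j : ℕ) : ℝ) * h)) * hch
  have hlog : ∀ i : Fin N, 0 ≤ -Real.log (((i : ℝ) + 1) / N) / h := by
    intro i
    refine div_nonneg (neg_nonneg.2 (Real.log_nonpos (by positivity) ?_)) hh.le
    rw [div_le_one hNR]
    exact_mod_cast i.2
  -- The rates solve e^{-r h} = k/N. The mass at k = 0 has infinite rate and is dropped: it
  -- contributes nothing to moments with n ≥ 1, and at 0 it leaves only an inequality.
  refine ⟨fun i => Real.toNNReal (lam (i + 1)),
    fun i => Real.toNNReal (-Real.log (((i : ℝ) + 1) / N) / h), ?_, ?_⟩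
  · simp only [expSum, mul_zero, Real.exp_zero, mul_one, Real.coe_toNNReal _ (hlam0 _)]
    rw [← hsum, Finset.sum_range_succ', Fin.sum_univ_eq_sum_range (fun i => lam (i + 1))]
    linarith [hlam0 0]
  · intro n hn1 hn
    have hval : expSum (fun i : Fin N => Real.toNNReal (lam (i + 1)))
        (fun i => Real.toNNReal (-Real.log (((i : ℝ) + 1) / N) / h)) (n * h) =
        ∑ k ∈ Finset.range (N + 1), lam k * ((k : ℝ) / N) ^ n := by
      rw [Finset.sum_range_succ', Nat.cast_zero, zero_div, zero_pow (by omega), mul_zero, add_zero,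
        ← Fin.sum_univ_eq_sum_range (fun i => lam (i + 1) * (((i + 1 : ℕ) : ℝ) / N) ^ n)]
      refine Finset.sum_congr rfl fun i _ => ?_
      rw [Real.coe_toNNReal _ (hlam0 _), Real.coe_toNNReal _ (hlog i)]
      have : -(-Real.log (((i : ℝ) + 1) / N) / h) * (n * h) = n * Real.log (((i : ℝ) + 1) / N) := by
        field_simp
      rw [this, Real.exp_nat_mul, Real.exp_log (by positivity)]
      push_cast
      rfl
    rw [hval, hmom n hn, ← Finset.sum_sub_distrib]
    calc |∑ k ∈ Finset.range (N + 1), (lam k * ((k.descFactorial n : ℝ) / N.descFactorial n) -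
          lam k * ((k : ℝ) / N) ^ n)|
        ≤ ∑ k ∈ Finset.range (N + 1), lam k * ((n : ℝ) ^ 2 / N) := by
          refine (Finset.abs_sum_le_sum_abs _ _).trans (Finset.sum_le_sum fun k hk => ?_)
          rw [← mul_sub, abs_mul, abs_of_nonneg (hlam0 k)]
          refine mul_le_mul_of_nonneg_left ?_ (hlam0 k)
          exact abs_descFactorial_div_sub_pow_le (by have := Finset.mem_range.1 hk; omega) n hn
      _ = _ := by rw [← Finset.sum_mul, hsum]

/-- A shifted completely monotonic function is a pointwise limit of exponential sums with
nonnegative coefficients. -/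
lemma IsCompletelyMonotonic.exists_tendsto_expSum {f : ℝ → ℝ} (hf : IsCompletelyMonotonic f)
    {a : ℝ} (ha : 0 < a) :
    ∃ (K : ℕ → ℕ) (c r : ∀ m, Fin (K m) → ℝ≥0), (∀ m, expSum (c m) (r m) 0 ≤ f a) ∧
      ∀ t, 0 < t → Tendsto (fun m => expSum (c m) (r m) t) atTop (𝓝 (f (a + t))) := by
  -- With mesh h = 1/(m + 1) a fixed t has n ≈ t(m + 1), and N = (m + 1)³ makes the error n²/N of
  -- order 1/m.
  have hex := fun m : ℕ => hf.exists_expSum ha (h := ((m : ℝ) + 1)⁻¹) (by positivity)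
    (N := (m + 1) ^ 3) (by positivity)
  choose c r h0 hap using hex
  refine ⟨fun m => (m + 1) ^ 3, c, r, h0, fun t ht => ?_⟩
  have hcast : Tendsto (fun m : ℕ => (m : ℝ) + 1) atTop atTop :=
    tendsto_atTop_add_const_right _ _ tendsto_natCast_atTop_atTop
  have hinv : Tendsto (fun m : ℕ => ((m : ℝ) + 1)⁻¹) atTop (𝓝 0) := tendsto_inv_atTop_zero.comp hcast
  set n : ℕ → ℕ := fun m => ⌊t * ((m : ℝ) + 1)⌋₊ with hn
  have hn1 : Tendsto (fun m => (n m : ℝ) * ((m : ℝ) + 1)⁻¹) atTop (𝓝 t) := by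
    simpa [div_eq_mul_inv, Function.comp_def] using (tendsto_nat_floor_mul_div_atTop ht.le).comp hcast
  have hn2 : Tendsto (fun m => ((n m + 1 : ℕ) : ℝ) * ((m : ℝ) + 1)⁻¹) atTop (𝓝 t) := by
    have := hn1.add hinv
    rw [add_zero] at this
    refine this.congr fun m => ?_
    push_cast; ring
  have hfc : ∀ s : ℕ → ℝ, Tendsto s atTop (𝓝 t) →
      Tendsto (fun m => f (a + s m)) atTop (𝓝 (f (a + t))) := fun s hs =>
    ((hf.contDiffAt (by positivity : 0 < a + t)).continuousAt.tendsto).comp (hs.const_add a)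
  have herr : ∀ k : ℕ → ℕ, Tendsto (fun m => (k m : ℝ) * ((m : ℝ) + 1)⁻¹) atTop (𝓝 t) →
      Tendsto (fun m => f a * ((k m : ℝ) ^ 2 / (((m + 1) ^ 3 : ℕ) : ℝ))) atTop (𝓝 0) := by
    intro k hk
    have := ((hk.pow 2).mul hinv).const_mul (f a)
    simp only [mul_zero] at this
    refine this.congr fun m => ?_
    push_cast
    field_simp
  have hbig : ∀ᶠ m : ℕ in atTop, 1 ≤ n m ∧ n m + 1 ≤ (m + 1) ^ 3 := by
    filter_upwards [hcast.eventually_ge_atTop (1 / t), hcast.eventually_ge_atTop (t + 1),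
      eventually_ge_atTop 1] with m h1 h2 h3
    constructor
    · refine Nat.le_floor ?_
      rw [div_le_iff₀ ht] at h1
      push_cast
      linarith
    · have h4 : (n m : ℝ) ≤ t * ((m : ℝ) + 1) := Nat.floor_le (by positivity)
      have h5 : (1 : ℝ) ≤ m := by exact_mod_cast h3
      have : ((n m + 1 : ℕ) : ℝ) ≤ (((m + 1) ^ 3 : ℕ) : ℝ) := by
        push_cast
        nlinarith [mul_le_mul_of_nonneg_right h2 (by positivity : (0:ℝ) ≤ (m : ℝ) + 1),
          mul_le_mul_of_nonneg_left h5 (by positivity : (0:ℝ) ≤ ((m : ℝ) + 1) ^ 2)]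
      exact_mod_cast this
  -- Off the grid, the sum at t is squeezed between its values at the neighbouring grid points, by
  -- monotonicity.
  refine tendsto_of_tendsto_of_tendsto_of_le_of_le'
    (g := fun m => f (a + ((n m + 1 : ℕ) : ℝ) * ((m : ℝ) + 1)⁻¹) -
      f a * (((n m + 1 : ℕ) : ℝ) ^ 2 / (((m + 1) ^ 3 : ℕ) : ℝ)))
    (h := fun m => f (a + (n m : ℝ) * ((m : ℝ) + 1)⁻¹) +
      f a * ((n m : ℝ) ^ 2 / (((m + 1) ^ 3 : ℕ) : ℝ))) ?_ ?_ ?_ ?_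
  · simpa using (hfc _ hn2).sub (herr (fun m => n m + 1) hn2)
  · simpa using (hfc _ hn1).add (herr n hn1)
  · filter_upwards [hbig] with m hm
    have h1 := (abs_le.1 (hap m (n m + 1) (by omega) hm.2)).2
    have h2 : expSum (c m) (r m) (((n m + 1 : ℕ) : ℝ) * ((m : ℝ) + 1)⁻¹) ≤ expSum (c m) (r m) t := by
      refine expSum_antitone _ _ ?_
      rw [← div_eq_mul_inv, le_div_iff₀ (by positivity)]
      push_cast
      exact (Nat.lt_floor_add_one _).le
    linarith
  · filter_upwards [hbig] with m hm
    have h1 := (abs_le.1 (hap m (n m) hm.1 (by omega))).1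
    have h2 : expSum (c m) (r m) t ≤ expSum (c m) (r m) ((n m : ℝ) * ((m : ℝ) + 1)⁻¹) := by
      refine expSum_antitone _ _ ?_
      rw [← div_eq_mul_inv, div_le_iff₀ (by positivity)]
      exact Nat.floor_le (by positivity)
    linarith

/-! ### Laplace transforms of completely monotonic functions -/

lemma norm_exp_neg_mul_ofReal (p : ℂ) (t : ℝ) : ‖Complex.exp (-p * t)‖ = Real.exp (-p.re * t) := by
  rw [Complex.norm_exp]; simp

lemma integrableOn_exp_neg_mul {b : ℝ} (hb : 0 < b) :
    IntegrableOn (fun t : ℝ => Real.exp (-b * t)) (Ioi 0) :=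
  exp_neg_integrableOn_Ioi 0 hb

lemma integrableOn_cexp_neg_mul {p : ℂ} (hp : 0 < p.re) :
    IntegrableOn (fun t : ℝ => Complex.exp (-p * t)) (Ioi 0) := by
  refine (integrableOn_exp_neg_mul hp).mono' (by fun_prop) (ae_of_all _ fun t => ?_)
  rw [norm_exp_neg_mul_ofReal]

lemma integral_cexp_neg_mul {p : ℂ} (hp : 0 < p.re) :
    ∫ t in Ioi (0 : ℝ), Complex.exp (-p * t) = 1 / p := by
  rw [integral_exp_mul_complex_Ioi (by simpa using hp)]
  simp

lemma laplace_expSum_mem {K : ℕ} (c r : Fin K → ℝ≥0) :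
    (fun p : RightHalfPlane => laplace (expSum c r) p) ∈ stieltjesCone := by
  have : (fun p : RightHalfPlane => laplace (expSum c r) p) = ∑ i, c i • stieltjesKernel (r i) := by
    ext p
    have hpr : ∀ i, 0 < ((p : ℂ) + (r i : ℝ)).re := fun i => by
      have := p.2; have := NNReal.coe_nonneg (r i); simp; linarith
    have hint : ∀ t : ℝ, ((expSum c r t : ℝ) : ℂ) * Complex.exp (-p * t) =
        ∑ i, ((c i : ℝ) : ℂ) * Complex.exp (-((p : ℂ) + (r i : ℝ)) * t) := by
      intro t
      simp only [expSum, Complex.ofReal_sum, Finset.sum_mul]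
      refine Finset.sum_congr rfl fun i _ => ?_
      push_cast
      rw [mul_assoc, ← Complex.exp_add]
      ring_nf
    simp only [laplace, hint]
    rw [integral_finsetSum _ fun i _ => (integrableOn_cexp_neg_mul (hpr i)).const_mul _]
    simp only [Finset.sum_apply, Pi.smul_apply, NNReal.smul_def, Complex.real_smul, stieltjesKernel]
    refine Finset.sum_congr rfl fun i _ => ?_
    rw [integral_const_mul, integral_cexp_neg_mul (hpr i)]
  rw [this]
  exact Submodule.sum_mem _ fun i _ => stieltjesCone.smul_mem _ (stieltjesKernel_mem _)

/-- The shift makes the value at 0 finite: all approximating sums are bounded by f(a), so dominated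
convergence carries the transforms to the limit. -/
lemma IsCompletelyMonotonic.laplace_shift_mem {f : ℝ → ℝ} (hf : IsCompletelyMonotonic f) {a : ℝ}
    (ha : 0 < a) : (fun p : RightHalfPlane => laplace (fun t => f (a + t)) p) ∈ stieltjesCone := by
  obtain ⟨K, c, r, h0, hlim⟩ := hf.exists_tendsto_expSum ha
  refine isClosed_stieltjesCone.mem_of_tendsto (b := (atTop : Filter ℕ))
    (f := fun m (p : RightHalfPlane) => laplace (expSum (c m) (r m)) p) ?_
    (Eventually.of_forall fun m => laplace_expSum_mem _ _)
  rw [tendsto_pi_nhds]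
  intro p
  refine tendsto_integral_of_dominated_convergence (fun t => f a * Real.exp (-(p : ℂ).re * t))
    (fun m => ?_) ((integrableOn_exp_neg_mul p.2).const_mul _) (fun m => ?_) ?_
  · unfold expSum
    fun_prop
  · filter_upwards [ae_restrict_mem measurableSet_Ioi] with t ht
    rw [norm_mul, norm_exp_neg_mul_ofReal, Complex.norm_real,
      Real.norm_of_nonneg (expSum_nonneg _ _ _)]
    gcongr
    exact (expSum_antitone _ _ (le_of_lt ht)).trans (h0 m)
  · filter_upwards [ae_restrict_mem measurableSet_Ioi] with t ht
    exact ((Complex.continuous_ofReal.tendsto _).comp (hlim t ht)).mul_const _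

lemma IsLICM.integrableOn_mul_exp {f : ℝ → ℝ} (hf : IsLICM f) {b : ℝ} (hb : 0 < b) :
    IntegrableOn (fun t => f t * Real.exp (-b * t)) (Ioi 0) := by
  have h1 : IntegrableOn f (Icc 0 1) :=
    hf.2.integrableOn_compact_subset Icc_subset_Ici_self isCompact_Icc
  rw [← Ioc_union_Ioi_eq_Ioi (zero_le_one' ℝ)]
  refine IntegrableOn.union ?_ ?_
  · refine (h1.mono_set Ioc_subset_Icc_self).mul_bdd (c := 1) (by fun_prop) ?_
    filter_upwards [ae_restrict_mem measurableSet_Ioc] with t ht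
    rw [Real.norm_of_nonneg (Real.exp_nonneg _), Real.exp_le_one_iff]
    nlinarith [ht.1]
  · refine Integrable.mono' (((integrableOn_exp_neg_mul hb).mono_set
      (Ioi_subset_Ioi zero_le_one)).const_mul (f 1)) ?_ ?_
    · refine ContinuousOn.aestronglyMeasurable ?_ measurableSet_Ioi
      refine ContinuousOn.mul ?_ (by fun_prop)
      exact hf.1.1.continuousOn.mono (Ioi_subset_Ioi zero_le_one)
    · filter_upwards [ae_restrict_mem measurableSet_Ioi] with t ht
      have ht0 : (0:ℝ) < t := zero_lt_one.trans ht
      rw [Real.norm_of_nonneg (mul_nonneg (hf.1.nonneg ht0) (Real.exp_nonneg _))]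
      gcongr
      exact hf.1.antitoneOn (mem_Ioi.2 one_pos) ht0 (le_of_lt ht)

lemma IsLICM.integrableOn_mul_cexp {f : ℝ → ℝ} (hf : IsLICM f) {p : ℂ} (hp : 0 < p.re) :
    IntegrableOn (fun t : ℝ => (f t : ℂ) * Complex.exp (-p * t)) (Ioi 0) := by
  refine Integrable.mono (hf.integrableOn_mul_exp hp) ?_ (ae_of_all _ fun t => ?_)
  · refine ContinuousOn.aestronglyMeasurable ?_ measurableSet_Ioi
    exact (Complex.continuous_ofReal.comp_continuousOn hf.1.1.continuousOn).mul (by fun_prop)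
  · rw [norm_mul, norm_mul, norm_exp_neg_mul_ofReal, Complex.norm_real,
      Real.norm_of_nonneg (Real.exp_nonneg _)]

/-- The Laplace transform of a locally integrable completely monotonic function is a Stieltjes
function. -/
lemma IsLICM.laplace_mem {f : ℝ → ℝ} (hf : IsLICM f) :
    (fun p : RightHalfPlane => laplace f p) ∈ stieltjesCone := by
  refine isClosed_stieltjesCone.mem_of_tendsto (b := 𝓝[>] (0 : ℝ))
    (f := fun a (p : RightHalfPlane) => laplace (fun t => f (a + t)) p) ?_
    (by filter_upwards [self_mem_nhdsWithin] with a ha using hf.1.laplace_shift_mem ha)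
  rw [tendsto_pi_nhds]
  intro p
  -- As a decreases to 0, f(a + t) ≤ f(t), and f is integrable near 0.
  refine tendsto_integral_filter_of_dominated_convergence
    (fun t => f t * Real.exp (-(p : ℂ).re * t)) ?_ ?_ (hf.integrableOn_mul_exp p.2) ?_
  · filter_upwards [self_mem_nhdsWithin] with a ha
    refine ContinuousOn.aestronglyMeasurable ?_ measurableSet_Ioi
    refine (Complex.continuous_ofReal.comp_continuousOn ?_).mul (by fun_prop)
    exact hf.1.1.continuousOn.comp (by fun_prop) fun t ht => add_pos (mem_Ioi.1 ha) ht
  · filter_upwards [self_mem_nhdsWithin] with a ha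
    filter_upwards [ae_restrict_mem measurableSet_Ioi] with t ht
    have hat : 0 < a + t := add_pos ha ht
    rw [norm_mul, norm_exp_neg_mul_ofReal, Complex.norm_real, Real.norm_of_nonneg (hf.1.nonneg hat)]
    gcongr
    exact hf.1.antitoneOn ht hat (le_add_of_nonneg_left (le_of_lt ha))
  · filter_upwards [ae_restrict_mem measurableSet_Ioi] with t ht
    refine Tendsto.mul_const _ ((Complex.continuous_ofReal.tendsto _).comp ?_)
    have h1 : Tendsto (fun a : ℝ => a + t) (𝓝[>] 0) (𝓝 t) := by
      have : Tendsto (fun a : ℝ => a + t) (𝓝 0) (𝓝 (0 + t)) :=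
        (continuous_id.add continuous_const).tendsto 0
      rw [zero_add] at this
      exact this.mono_left nhdsWithin_le_nhds
    exact (hf.1.contDiffAt ht).continuousAt.tendsto.comp h1

lemma IsLICM.le_of_tendsto {G : ℝ → ℝ} (hG : IsLICM G) {Ginf : ℝ}
    (hlim : Tendsto G atTop (𝓝 Ginf)) {x : ℝ} (hx : 0 < x) : Ginf ≤ G x := by
  refine _root_.le_of_tendsto hlim ?_
  filter_upwards [eventually_ge_atTop x] with y hy
  exact hG.1.antitoneOn hx (hx.trans_le hy) hy

/-- The complex modulus has real part at least `G_∞`. -/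
lemma IsLICM.le_re_complexModulus {G : ℝ → ℝ} (hG : IsLICM G) {Ginf : ℝ}
    (hlim : Tendsto G atTop (𝓝 Ginf)) {p : ℂ} (hp : 0 < p.re) :
    Ginf ≤ (complexModulus G p).re := by
  have hp0 : p ≠ 0 := fun h => by simp [h] at hp
  -- Removing the limit keeps the class, and the constant contributes exactly G_∞ to Q; the
  -- remaining term p H̃(p), with H = G - G_∞, has nonnegative real part.
  have hH : IsLICM (fun t => G t - Ginf) :=
    ⟨hG.1.sub_const fun x hx => hG.le_of_tendsto hlim hx,
      hG.2.sub (continuous_const.locallyIntegrable.locallyIntegrableOn _)⟩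
  have h1 : laplace G p = laplace (fun t => G t - Ginf) p + Ginf / p := by
    unfold laplace
    have h2 : ∫ t in Ioi (0 : ℝ), (Ginf : ℂ) * Complex.exp (-p * t) = Ginf / p := by
      rw [integral_const_mul, integral_cexp_neg_mul hp, mul_one_div]
    rw [← h2, ← integral_add (hH.integrableOn_mul_cexp hp)
      ((integrableOn_cexp_neg_mul hp).const_mul _)]
    refine integral_congr_ae (ae_of_all _ fun t => ?_)
    push_cast
    ring
  have h3 := re_mul_nonneg_of_mem hH.laplace_mem ⟨p, hp⟩
  rw [complexModulus, h1, mul_add, mul_div_cancel₀ _ hp0, Complex.add_re, Complex.ofReal_re]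
  simp only at h3
  linarith

/-! ### Representing measures on the compactified half-line -/

lemma RightHalfPlane.mul_add_one_sub_ne_zero (p : RightHalfPlane) (x : unitInterval) :
    (p : ℂ) * (x : ℝ) + (1 - (x : ℝ)) ≠ 0 := by
  intro h
  have h1 := congrArg Complex.re h
  have hp := p.2
  have h2 := x.2.1
  have h3 := x.2.2
  simp at h1
  rcases h2.eq_or_lt with h0 | h0
  · rw [← h0] at h1
    simp at h1
  · linarith [mul_pos hp h0]

/-- The functions `x ↦ 1 / (p x + 1 - x)` on `[0, 1]`: in the variable `x = 1 / (1 + r)`, these are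
the normalized Stieltjes kernels `(1 + r) / (p + r)`. -/
def unitKernel (p : RightHalfPlane) : BoundedContinuousFunction unitInterval ℂ :=
  BoundedContinuousFunction.mkOfCompact
    ⟨fun x => 1 / ((p : ℂ) * (x : ℝ) + (1 - (x : ℝ))),
      continuous_const.div (by fun_prop) p.mul_add_one_sub_ne_zero⟩

lemma unitKernel_apply (p : RightHalfPlane) (x : unitInterval) :
    unitKernel p x = 1 / ((p : ℂ) * (x : ℝ) + (1 - (x : ℝ))) := rfl

/-- The function `p ↦ ∫ 1 / (p x + 1 - x) σ(dx)`. -/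
def unitTransform (σ : FiniteMeasure unitInterval) (p : RightHalfPlane) : ℂ :=
  ∫ x, unitKernel p x ∂(σ : Measure unitInterval)

lemma continuous_unitTransform : Continuous unitTransform := by
  refine continuous_pi fun p => continuous_iff_continuousAt.2 fun σ => ?_
  exact (FiniteMeasure.tendsto_iff_forall_integral_rclike_tendsto ℂ).1 tendsto_id (unitKernel p)

lemma unitTransform_add (σ τ : FiniteMeasure unitInterval) :
    unitTransform (σ + τ) = unitTransform σ + unitTransform τ := by
  ext p
  simp only [unitTransform, FiniteMeasure.toMeasure_add, Pi.add_apply]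
  exact integral_add_measure ((unitKernel p).integrable _) ((unitKernel p).integrable _)

lemma unitTransform_smul (c : ℝ≥0) (σ : FiniteMeasure unitInterval) :
    unitTransform (c • σ) = c • unitTransform σ := by
  ext p
  simp only [unitTransform, FiniteMeasure.toMeasure_smul, Pi.smul_apply]
  exact integral_smul_nnreal_measure _ c

lemma exists_unitTransform_eq_of_mem_span {u : RightHalfPlane → ℂ}
    (hu : u ∈ Submodule.span ℝ≥0 (range stieltjesKernel)) : ∃ σ, unitTransform σ = u := by
  induction hu using Submodule.span_induction with
  | mem u hu =>
    obtain ⟨r, rfl⟩ := hu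
    have hr0 : (0:ℝ) ≤ r := r.2
    have hx : (1 + (r : ℝ))⁻¹ ∈ Icc (0:ℝ) 1 := ⟨by positivity, inv_le_one_of_one_le₀ (by linarith)⟩
    let σ : FiniteMeasure unitInterval := ⟨Measure.dirac ⟨_, hx⟩, inferInstance⟩
    -- The weight undoes the normalization (1 + r)/(p + r) of the kernel.
    refine ⟨(1 + r)⁻¹ • σ, ?_⟩
    rw [unitTransform_smul]
    ext p
    have h0 := p.add_ofReal_ne_zero hr0
    have h1 : (1 : ℂ) + (r : ℝ) ≠ 0 := by exact_mod_cast (by positivity : 1 + (r : ℝ) ≠ 0)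
    have h2 : unitTransform σ p = unitKernel p ⟨_, hx⟩ := integral_dirac _ _
    rw [Pi.smul_apply, h2, unitKernel_apply, stieltjesKernel, NNReal.smul_def, Complex.real_smul]
    have h3 : (p : ℂ) * (((1 + (r : ℝ))⁻¹ : ℝ) : ℂ) + (1 - (((1 + (r : ℝ))⁻¹ : ℝ) : ℂ)) =
        ((p : ℂ) + (r : ℝ)) / (1 + (r : ℝ)) := by
      push_cast
      field_simp
      ring
    rw [h3]
    push_cast
    field_simp
  | zero => exact ⟨0, by ext p; simp [unitTransform]⟩
  | add u v _ _ hu hv =>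
    obtain ⟨σ, rfl⟩ := hu
    obtain ⟨τ, rfl⟩ := hv
    exact ⟨σ + τ, unitTransform_add σ τ⟩
  | smul c u _ hu =>
    obtain ⟨σ, rfl⟩ := hu
    exact ⟨c • σ, unitTransform_smul c σ⟩

/-- Integral representation of Stieltjes functions by finite measures on `[0, 1]`. -/
lemma exists_unitTransform_eq {f : RightHalfPlane → ℂ} (hf : f ∈ stieltjesCone) :
    ∃ σ, unitTransform σ = f := by
  let e : RightHalfPlane := ⟨1, by simp⟩
  -- At p = 1 the kernel is identically 1, so the value there is the total mass. Near f the masses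
  -- are thus bounded, and the measures of mass at most M form a weakly compact set, whose image is
  -- closed.
  let M : ℝ := (f e).re + 1
  let U : Set (RightHalfPlane → ℂ) := {u | (u e).re < M}
  have hU : IsOpen U := isOpen_lt (by fun_prop) continuous_const
  have hmem := hU.inter_closure (t := (Submodule.span ℝ≥0 (range stieltjesKernel) : Set _))
    ⟨show (f e).re < M from lt_add_one _, mem_stieltjesCone_iff.1 hf⟩
  have hcl : IsClosed (unitTransform '' {σ : FiniteMeasure unitInterval | σ.mass ≤ M.toNNReal}) :=
    ((isCompact_setOfPred_finiteMeasure_le_of_compactSpace unitInterval _).image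
      continuous_unitTransform).isClosed
  have hsub : U ∩ (Submodule.span ℝ≥0 (range stieltjesKernel) : Set _) ⊆
      unitTransform '' {σ : FiniteMeasure unitInterval | σ.mass ≤ M.toNNReal} := by
    rintro u ⟨hu1, hu2⟩
    obtain ⟨σ, rfl⟩ := exists_unitTransform_eq_of_mem_span hu2
    refine ⟨σ, ?_, rfl⟩
    have h1 : unitTransform σ e = ((σ.mass : ℝ) : ℂ) := by
      have : ∀ x, unitKernel e x = 1 := fun x => by simp [unitKernel_apply, e]
      simp only [unitTransform, this, integral_const]
      rw [Complex.real_smul, mul_one]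
      rfl
    have h2 : (unitTransform σ e).re < M := hu1
    rw [h1, Complex.ofReal_re] at h2
    exact NNReal.le_toNNReal_of_coe_le h2.le
  obtain ⟨σ, -, h⟩ := closure_minimal hsub hcl hmem
  exact ⟨σ, h⟩

/-! ### From [0, 1] to the spectral measure -/

lemma isLocallyFiniteMeasure_of_lintegral_lt_top {ν : Measure ℝ} (h0 : ν (Iic 0) = 0)
    (h : ∫⁻ r in Ioi (0 : ℝ), ENNReal.ofReal (1 / (1 + r)) ∂ν < ⊤) : IsLocallyFiniteMeasure ν := by
  refine ⟨fun x => ⟨Iio (|x| + 1), Iio_mem_nhds (by linarith [le_abs_self x]), ?_⟩⟩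
  set R : ℝ := |x| + 1
  have hR : 0 < 1 + R := by positivity
  have hfin : ν (Ioo 0 R) < ⊤ := by
    have h1 : ENNReal.ofReal (1 / (1 + R)) * ν (Ioo 0 R) ≤
        ∫⁻ r in Ioi (0 : ℝ), ENNReal.ofReal (1 / (1 + r)) ∂ν := by
      rw [← setLIntegral_const]
      refine (setLIntegral_mono' measurableSet_Ioo fun r hr => ?_).trans
        (lintegral_mono_set Ioo_subset_Ioi_self)
      have := hr.1
      have := hr.2
      exact ENNReal.ofReal_le_ofReal (one_div_le_one_div_of_le (by linarith) (by linarith))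
    have h2 : ENNReal.ofReal (1 / (1 + R)) ≠ 0 := by
      simpa using hR
    exact ENNReal.lt_top_of_mul_ne_top_right (h1.trans_lt h).ne h2
  refine (measure_mono (t := Iic 0 ∪ Ioo 0 R) fun y hy => ?_).trans_lt
    ((measure_union_le _ _).trans_lt (by rw [h0, zero_add]; exact hfin))
  rcases le_or_gt y 0 with hy0 | hy0
  · exact Or.inl hy0
  · exact Or.inr ⟨hy0, hy⟩

/-- The change of variables `x = 1 / (1 + r)` applied to a finite measure on `[0, 1]`. -/
def spectralMeasureOf (σ : Measure unitInterval) : Measure ℝ :=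
  ((σ.restrict (Ioo 0 1)).withDensity fun x => ((Real.toNNReal (1 / (x : ℝ)) : ℝ≥0) : ENNReal)).map
    fun x : unitInterval => (1 - (x : ℝ)) / x

lemma measurable_spectralVariable : Measurable fun x : unitInterval => (1 - (x : ℝ)) / x := by
  fun_prop

lemma measurable_spectralDensity :
    Measurable fun x : unitInterval => Real.toNNReal (1 / (x : ℝ)) := by
  fun_prop

lemma spectralMeasureOf_Iic (σ : Measure unitInterval) : spectralMeasureOf σ (Iic 0) = 0 := by
  rw [spectralMeasureOf, Measure.map_apply measurable_spectralVariable measurableSet_Iic]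
  refine withDensity_absolutelyContinuous _ _ ?_
  rw [Measure.restrict_apply (measurable_spectralVariable measurableSet_Iic)]
  convert measure_empty (μ := σ)
  ext x
  simp only [mem_inter_iff, mem_preimage, mem_Iic, mem_empty_iff_false, iff_false, not_and]
  rintro h ⟨h1, h2⟩
  have h1' : (0:ℝ) < x := h1
  have h2' : (x:ℝ) < 1 := h2
  have : 0 < (1 - (x : ℝ)) / x := div_pos (by linarith) h1'
  linarith

lemma spectralMeasureOf_restrict (σ : Measure unitInterval) :
    (spectralMeasureOf σ).restrict (Ioi 0) = spectralMeasureOf σ := by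
  refine Measure.restrict_eq_self_of_ae_mem ?_
  rw [ae_iff]
  convert spectralMeasureOf_Iic σ using 2
  ext x
  simp

lemma isSpectralMeasure_spectralMeasureOf (σ : Measure unitInterval) [IsFiniteMeasure σ] :
    IsSpectralMeasure (spectralMeasureOf σ) := by
  have h : ∫⁻ r in Ioi (0 : ℝ), ENNReal.ofReal (1 / (1 + r)) ∂(spectralMeasureOf σ) < ⊤ := by
    rw [spectralMeasureOf_restrict, spectralMeasureOf,
      lintegral_map (by fun_prop) measurable_spectralVariable,
      lintegral_withDensity_eq_lintegral_mul _ measurable_spectralDensity.coe_nnreal_ennreal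
        (by fun_prop)]
    -- With r = (1 - x)/x one has 1/(1 + r) = x, which cancels the density 1/x.
    refine (setLIntegral_mono' (g := fun _ => 1) measurableSet_Ioo fun x hx => ?_).trans_lt ?_
    · have h1 : (0:ℝ) < x := hx.1
      have h2 : (x:ℝ) < 1 := hx.2
      rw [Pi.mul_apply, ENNReal.ofNNReal_toNNReal, ← ENNReal.ofReal_mul (by positivity),
        ENNReal.ofReal_le_one]
      apply le_of_eq
      field_simp
      ring
    · simp
  exact ⟨isLocallyFiniteMeasure_of_lintegral_lt_top (spectralMeasureOf_Iic σ) h,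
    spectralMeasureOf_Iic σ, h⟩

lemma integral_spectralMeasureOf (σ : Measure unitInterval) (p : RightHalfPlane) :
    ∫ r in Ioi (0 : ℝ), 1 / ((p : ℂ) + (r : ℂ)) ∂(spectralMeasureOf σ) =
      ∫ x in Ioo 0 1, unitKernel p x ∂σ := by
  rw [spectralMeasureOf_restrict, spectralMeasureOf,
    integral_map measurable_spectralVariable.aemeasurable
      (Measurable.aestronglyMeasurable (by fun_prop)),
    integral_withDensity_eq_integral_smul measurable_spectralDensity]
  refine setIntegral_congr_fun measurableSet_Ioo fun x hx => ?_
  have h1 : (0:ℝ) < x := hx.1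
  have h1' : ((x : ℝ) : ℂ) ≠ 0 := by exact_mod_cast h1.ne'
  simp only [NNReal.smul_def, Complex.real_smul]
  rw [Real.coe_toNNReal _ (by positivity), unitKernel_apply]
  have h2 : (p : ℂ) + (((1 - (x : ℝ)) / x : ℝ) : ℂ) =
      ((p : ℂ) * (x : ℝ) + (1 - (x : ℝ))) / (x : ℝ) := by
    push_cast
    field_simp
  rw [h2]
  push_cast
  have h3 := p.mul_add_one_sub_ne_zero x
  field_simp

/-- The endpoints x = 0 and x = 1 correspond to r = ∞ and r = 0, where the kernel is 1 and 1/p. -/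
lemma unitTransform_eq (σ : FiniteMeasure unitInterval) (p : RightHalfPlane) :
    unitTransform σ p = (((σ : Measure unitInterval).real {0} : ℝ) : ℂ) +
      (((σ : Measure unitInterval).real {1} : ℝ) : ℂ) / p +
      ∫ x in Ioo 0 1, unitKernel p x ∂(σ : Measure unitInterval) := by
  have hi : ∀ s, IntegrableOn (unitKernel p) s (σ : Measure unitInterval) := fun s =>
    ((unitKernel p).integrable _).integrableOn
  have huniv : (univ : Set unitInterval) = ({0} ∪ {1}) ∪ Ioo 0 1 := by
    ext x
    simp only [mem_univ, mem_union, mem_singleton_iff, mem_Ioo, true_iff]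
    rcases (unitInterval.nonneg' (t := x)).eq_or_lt with h | h
    · exact Or.inl (Or.inl h.symm)
    rcases (unitInterval.le_one' (t := x)).eq_or_lt with h' | h'
    · exact Or.inl (Or.inr h')
    · exact Or.inr ⟨h, h'⟩
  rw [unitTransform, ← setIntegral_univ, huniv, setIntegral_union _ measurableSet_Ioo (hi _) (hi _),
    setIntegral_union _ (measurableSet_singleton _) (hi _) (hi _), integral_singleton,
    integral_singleton, unitKernel_apply, unitKernel_apply]
  · simp [div_eq_mul_inv]
  · simp
  · rw [disjoint_iff_forall_ne]
    rintro a (rfl | rfl) b hb rfl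
    · exact lt_irrefl _ hb.1
    · exact lt_irrefl _ hb.2

/-- Integral representation of bounded Stieltjes functions. -/
lemma exists_spectralMeasure {f : RightHalfPlane → ℂ} (hf : f ∈ stieltjesCone) {C : ℝ}
    (hC : ∀ p, ‖f p‖ ≤ C) :
    ∃ (B : ℝ) (ν : Measure ℝ), 0 ≤ B ∧ IsSpectralMeasure ν ∧
      ∀ p : RightHalfPlane, f p = B + ∫ r in Ioi (0 : ℝ), 1 / ((p : ℂ) + (r : ℂ)) ∂ν := by
  obtain ⟨σ, rfl⟩ := exists_unitTransform_eq hf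
  -- At real p = x > 0 the other terms have nonnegative real part, so boundedness gives σ{1}/x ≤ C;
  -- let x tend to 0.
  have hzero : (σ : Measure unitInterval).real {1} = 0 := by
    refine le_antisymm ?_ measureReal_nonneg
    have hle : ∀ x : ℝ, 0 < x → (σ : Measure unitInterval).real {1} ≤ C * x := by
      intro x hx
      let p : RightHalfPlane := ⟨x, by simpa using hx⟩
      have h1 := hC p
      have h2 : 0 ≤ (∫ y in Ioo 0 1, unitKernel p y ∂(σ : Measure unitInterval)).re := by
        have hre : (∫ y in Ioo 0 1, unitKernel p y ∂(σ : Measure unitInterval)).re =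
            ∫ y in Ioo 0 1, (unitKernel p y).re ∂(σ : Measure unitInterval) :=
          (integral_re ((unitKernel p).integrable _).integrableOn).symm
        rw [hre]
        refine integral_nonneg fun y => ?_
        have : unitKernel p y = ((1 / (x * y + (1 - y)) : ℝ) : ℂ) := by
          rw [unitKernel_apply]; push_cast; rfl
        rw [this, Complex.ofReal_re]
        have h3 := y.2.1
        have h4 := y.2.2
        have : 0 ≤ 1 - (y : ℝ) := by linarith
        show (0:ℝ) ≤ _
        positivity
      have h3 := (Complex.re_le_norm _).trans h1
      rw [unitTransform_eq, Complex.add_re, Complex.add_re, Complex.ofReal_re,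
        show ((p : ℂ)) = (x : ℂ) from rfl, ← Complex.ofReal_div, Complex.ofReal_re] at h3
      have h4 : 0 ≤ (σ : Measure unitInterval).real {0} := measureReal_nonneg
      rw [← div_le_iff₀ hx]
      linarith
    have hlim : Tendsto (fun x : ℝ => C * x) (𝓝[>] 0) (𝓝 0) := by
      have : Tendsto (fun x : ℝ => C * x) (𝓝 0) (𝓝 (C * 0)) :=
        (continuous_const.mul continuous_id).tendsto 0
      rw [mul_zero] at this
      exact this.mono_left nhdsWithin_le_nhds
    exact ge_of_tendsto hlim (by filter_upwards [self_mem_nhdsWithin] with x hx using hle x hx)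
  refine ⟨(σ : Measure unitInterval).real {0}, spectralMeasureOf σ, measureReal_nonneg,
    isSpectralMeasure_spectralMeasureOf _, fun p => ?_⟩
  rw [unitTransform_eq, hzero, integral_spectralMeasureOf]
  simp

/-! ### The wave number: representation and limit at the origin -/

/-- The function `p ↦ Q(p)^{-1/2}` is a Stieltjes function. -/
lemma IsLICM.inv_sqrt_complexModulus_mem {G : ℝ → ℝ} (hG : IsLICM G) {Ginf : ℝ}
    (hlim : Tendsto G atTop (𝓝 Ginf)) (hpos : 0 < Ginf) :
    (fun p : RightHalfPlane => (complexModulus G p ^ (1 / 2 : ℂ))⁻¹) ∈ stieltjesCone := by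
  have hre : ∀ p : RightHalfPlane, 0 < (complexModulus G p).re := fun p =>
    hpos.trans_le (hG.le_re_complexModulus hlim p.2)
  have hne : ∀ p : RightHalfPlane, complexModulus G p ≠ 0 := fun p h => by
    have := hre p; simp [h] at this
  -- Re Q > 0 puts the argument of the principal root within π/4, so the root and its inverse have
  -- positive real part. The square is 1/(p G̃(p)).
  refine mem_of_sq_mem (fun p => ?_) ?_
  · rw [Complex.inv_re]
    have h1 : 0 < (complexModulus G p ^ (1 / 2 : ℂ)).re := by
      rw [Complex.cpow_def_of_ne_zero (hne p), Complex.exp_re]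
      refine mul_pos (Real.exp_pos _) (Real.cos_pos_of_mem_Ioo ?_)
      have h2 := Complex.abs_arg_lt_pi_div_two_iff.2 (Or.inl (hre p))
      have h3 : (Complex.log (complexModulus G p) * (1 / 2 : ℂ)).im =
          (complexModulus G p).arg / 2 := by
        rw [show (1 / 2 : ℂ) = ((1 / 2 : ℝ) : ℂ) by push_cast; rfl, Complex.im_mul_ofReal,
          Complex.log_im]
        ring
      rw [h3]
      have h4 := abs_lt.1 h2
      constructor <;> linarith [Real.pi_pos, h4.1, h4.2]
    refine div_pos h1 (Complex.normSq_pos.2 fun h => ?_)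
    rw [h, Complex.zero_re] at h1
    exact lt_irrefl _ h1
  · have h := inv_mul_mem hG.laplace_mem fun p h => hne p (by rw [complexModulus, h, mul_zero])
    convert h using 2 with p
    rw [inv_pow, ← Complex.cpow_nat_mul]
    simp [complexModulus]

/-- From |Q^{1/2}|² = |Q| ≥ Re Q ≥ G_∞. The bound excludes a 1/p term in the representation and
forces κ(p) → 0. -/
lemma IsLICM.norm_inv_sqrt_complexModulus_le {G : ℝ → ℝ} (hG : IsLICM G) {Ginf : ℝ}
    (hlim : Tendsto G atTop (𝓝 Ginf)) (hpos : 0 < Ginf) {p : ℂ} (hp : 0 < p.re) :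
    ‖(complexModulus G p ^ (1 / 2 : ℂ))⁻¹‖ ≤ (Real.sqrt Ginf)⁻¹ := by
  have h1 : Ginf ≤ ‖complexModulus G p‖ :=
    (hG.le_re_complexModulus hlim hp).trans (Complex.re_le_norm _)
  rw [norm_inv]
  refine inv_anti₀ (Real.sqrt_pos.2 hpos) (Real.sqrt_le_iff.2 ⟨norm_nonneg _, ?_⟩)
  rwa [← norm_pow, ← Complex.cpow_nat_mul, Nat.cast_ofNat, mul_one_div_cancel two_ne_zero,
    Complex.cpow_one]

lemma waveNumber_eq (ρ : ℝ) (G : ℝ → ℝ) (p : ℂ) : waveNumber ρ G p =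
    p * ((Real.sqrt ρ : ℂ) * (complexModulus G p ^ (1 / 2 : ℂ))⁻¹) := by
  rw [waveNumber, div_eq_mul_inv]
  ring

lemma IsLICM.exists_waveNumber_eq {G : ℝ → ℝ} (hG : IsLICM G) {Ginf : ℝ}
    (hlim : Tendsto G atTop (𝓝 Ginf)) (hpos : 0 < Ginf) (ρ : ℝ) :
    ∃ (B : ℝ) (ν : Measure ℝ), 0 ≤ B ∧ IsSpectralMeasure ν ∧
      ∀ p : ℂ, 0 < p.re → waveNumber ρ G p = (B : ℂ) * p + dispersionAttenuation ν p := by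
  have hmem := stieltjesCone.smul_mem (Real.toNNReal (Real.sqrt ρ))
    (hG.inv_sqrt_complexModulus_mem hlim hpos)
  obtain ⟨B, ν, hB, hν, h⟩ := exists_spectralMeasure (C := Real.sqrt ρ * (Real.sqrt Ginf)⁻¹) hmem
    (fun p => by
      rw [Pi.smul_apply, NNReal.smul_def, norm_smul, Real.coe_toNNReal _ (Real.sqrt_nonneg _),
        Real.norm_of_nonneg (Real.sqrt_nonneg _)]
      exact mul_le_mul_of_nonneg_left (hG.norm_inv_sqrt_complexModulus_le hlim hpos p.2)
        (Real.sqrt_nonneg _))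
  refine ⟨B, ν, hB, hν, fun p hp => ?_⟩
  have h1 := h ⟨p, hp⟩
  rw [Pi.smul_apply, NNReal.smul_def, Complex.real_smul,
    Real.coe_toNNReal _ (Real.sqrt_nonneg _)] at h1
  rw [waveNumber_eq, h1, dispersionAttenuation]
  ring

lemma IsLICM.tendsto_waveNumber {G : ℝ → ℝ} (hG : IsLICM G) {Ginf : ℝ}
    (hlim : Tendsto G atTop (𝓝 Ginf)) (hpos : 0 < Ginf) (ρ : ℝ) :
    Tendsto (waveNumber ρ G) (𝓝[{p : ℂ | 0 < p.re}] 0) (𝓝 0) := by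
  have h0 : Tendsto (fun p : ℂ => ‖p‖ * (Real.sqrt ρ * (Real.sqrt Ginf)⁻¹))
      (𝓝[{p : ℂ | 0 < p.re}] 0) (𝓝 0) := by
    have : Tendsto (fun p : ℂ => ‖p‖ * (Real.sqrt ρ * (Real.sqrt Ginf)⁻¹)) (𝓝 0)
        (𝓝 (‖(0 : ℂ)‖ * (Real.sqrt ρ * (Real.sqrt Ginf)⁻¹))) :=
      (continuous_norm.mul continuous_const).tendsto 0
    rw [norm_zero, zero_mul] at this
    exact this.mono_left nhdsWithin_le_nhds
  refine squeeze_zero_norm' ?_ h0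
  filter_upwards [self_mem_nhdsWithin] with p hp
  rw [waveNumber_eq, norm_mul, norm_mul, Complex.norm_real, Real.norm_of_nonneg (Real.sqrt_nonneg _)]
  have := hG.norm_inv_sqrt_complexModulus_le hlim hpos hp
  gcongr

/-! ### The Bernstein function attached to a spectral measure -/

lemma exists_one_add_le_exp {b : ℝ} (hb : 0 < b) :
    ∃ C : ℝ, 0 ≤ C ∧ ∀ r : ℝ, 0 ≤ r → 1 + r ≤ C * Real.exp (b * r) := by
  refine ⟨1 + b⁻¹, by positivity, fun r hr => ?_⟩
  have h1 := Real.add_one_le_exp (b * r)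
  calc 1 + r ≤ (1 + b⁻¹) * (b * r + 1) := by
        have : (1 + b⁻¹) * (b * r + 1) = 1 + r + (b * r + b⁻¹) := by field_simp; ring
        rw [this]
        have : 0 ≤ b * r + b⁻¹ := by positivity
        linarith
    _ ≤ _ := by gcongr

lemma IsCompletelyMonotonic.congr {f g : ℝ → ℝ} (hf : IsCompletelyMonotonic f)
    (h : EqOn g f (Ioi 0)) : IsCompletelyMonotonic g := by
  refine ⟨hf.1.congr h, fun n x hx => ?_⟩
  rw [Filter.EventuallyEq.iteratedDeriv_eq n (h.eventuallyEq_of_mem (Ioi_mem_nhds hx))]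
  exact hf.2 n x hx

/-- The kernel `(1 - e^{-rt}) / r` of Bernstein functions. -/
def bernsteinKernel (t r : ℝ) : ℝ := (1 - Real.exp (-r * t)) / r

lemma bernsteinKernel_nonneg {t r : ℝ} (ht : 0 ≤ t) (hr : 0 < r) : 0 ≤ bernsteinKernel t r := by
  refine div_nonneg (sub_nonneg.2 (Real.exp_le_one_iff.2 ?_)) hr.le
  nlinarith [mul_nonneg hr.le ht]

/-- Combines 1 - e^{-rt} ≤ rt with 1 - e^{-rt} ≤ 1, giving a bound integrable in r that grows
linearly in t. -/
lemma bernsteinKernel_le {t r : ℝ} (hr : 0 < r) :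
    bernsteinKernel t r ≤ (1 + t) * (1 / (1 + r)) := by
  rw [bernsteinKernel, mul_one_div, div_le_div_iff₀ hr (by linarith)]
  have h1 := Real.add_one_le_exp (-r * t)
  have h2 := Real.exp_pos (-r * t)
  nlinarith

lemma integral_bernsteinKernel_mul_exp {x r : ℝ} (hx : 0 < x) (hr : 0 < r) :
    ∫ t in Ioi (0 : ℝ), bernsteinKernel t r * Real.exp (-x * t) = x⁻¹ * (1 / (x + r)) := by
  have hexp : ∀ b : ℝ, 0 < b → ∫ t in Ioi (0 : ℝ), Real.exp (-b * t) = b⁻¹ := fun b hb => by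
    rw [integral_exp_mul_Ioi (by linarith)]
    simp [neg_div_neg_eq]
  have h1 : ∀ t, bernsteinKernel t r * Real.exp (-x * t) =
      r⁻¹ * (Real.exp (-x * t) - Real.exp (-(x + r) * t)) := by
    intro t
    rw [show -(x + r) * t = -r * t + -x * t by ring, Real.exp_add, bernsteinKernel]
    ring
  simp only [h1]
  rw [integral_const_mul, integral_sub (integrableOn_exp_neg_mul hx)
    (integrableOn_exp_neg_mul (by positivity)), hexp x hx, hexp _ (by positivity)]
  field_simp
  ring

namespace IsSpectralMeasure

variable {ν : Measure ℝ}

lemma integrable_inv (hν : IsSpectralMeasure ν) : Integrable (fun r : ℝ => 1 / (1 + r)) (ν.restrict (Ioi 0)) := by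
  refine ⟨Measurable.aestronglyMeasurable (by fun_prop), ?_⟩
  rw [hasFiniteIntegral_iff_norm]
  refine lt_of_eq_of_lt (setLIntegral_congr_fun measurableSet_Ioi fun r hr => ?_) hν.2.2
  have : (0:ℝ) < r := hr
  rw [Real.norm_of_nonneg (by positivity)]

lemma integrable_exp (hν : IsSpectralMeasure ν) {t : ℝ} (ht : 0 < t) :
    Integrable (fun r : ℝ => Real.exp (-r * t)) (ν.restrict (Ioi 0)) := by
  obtain ⟨C, hC, h⟩ := exists_one_add_le_exp ht
  refine (hν.integrable_inv.const_mul C).mono' (by fun_prop) ?_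
  filter_upwards [ae_restrict_mem measurableSet_Ioi] with r hr
  have hr0 : (0:ℝ) < r := hr
  rw [Real.norm_of_nonneg (Real.exp_nonneg _), mul_one_div, le_div_iff₀ (by positivity),
    show -r * t = -(t * r) by ring, Real.exp_neg, inv_mul_le_iff₀ (Real.exp_pos _)]
  linarith [h r hr0.le]

lemma integrable_bernsteinKernel (hν : IsSpectralMeasure ν) {t : ℝ} (ht : 0 ≤ t) :
    Integrable (bernsteinKernel t) (ν.restrict (Ioi 0)) := by
  refine (hν.integrable_inv.const_mul (1 + t)).mono'
    (Measurable.aestronglyMeasurable (by unfold bernsteinKernel; fun_prop)) ?_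
  filter_upwards [ae_restrict_mem measurableSet_Ioi] with r hr
  rw [Real.norm_of_nonneg (bernsteinKernel_nonneg ht hr)]
  exact bernsteinKernel_le hr

/-- As a moment generating function of -r, the integral ∫ e^{-rt} ν(dr) is analytic for t > 0, with
n-th derivative ∫ (-r)ⁿ e^{-rt} ν(dr). -/
lemma isCompletelyMonotonic_mgf (hν : IsSpectralMeasure ν) :
    IsCompletelyMonotonic (ProbabilityTheory.mgf (fun r : ℝ => -r) (ν.restrict (Ioi 0))) := by
  have hsub : Ioi (0:ℝ) ⊆ interior
      (ProbabilityTheory.integrableExpSet (fun r : ℝ => -r) (ν.restrict (Ioi 0))) := by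
    refine isOpen_Ioi.subset_interior_iff.2 fun t ht => ?_
    refine (hν.integrable_exp ht).congr (ae_of_all _ fun r => ?_)
    simp only
    ring_nf
  refine ⟨(ProbabilityTheory.analyticOnNhd_mgf.mono hsub).contDiffOn isOpen_Ioi.uniqueDiffOn,
    fun n x hx => ?_⟩
  rw [ProbabilityTheory.iteratedDeriv_mgf (hsub hx), ← integral_const_mul]
  refine setIntegral_nonneg measurableSet_Ioi fun r hr => ?_
  have hr0 : (0:ℝ) < r := hr
  rw [← mul_assoc, ← mul_pow]
  have : (-1 : ℝ) * -r = r := by ring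
  rw [this]
  positivity

/-- The Bernstein function with Lévy triple `(B, 0, ν(dr) / r)`. -/
lemma isBernstein (hν : IsSpectralMeasure ν) {B : ℝ} (hB : 0 ≤ B) :
    IsBernstein (fun t => B + ∫ r in Ioi (0 : ℝ), bernsteinKernel t r ∂ν) := by
  have hderiv : ∀ t : ℝ, 0 < t →
      HasDerivAt (fun t => B + ∫ r in Ioi (0 : ℝ), bernsteinKernel t r ∂ν)
        (∫ r in Ioi (0 : ℝ), Real.exp (-r * t) ∂ν) t := by
    intro t ht
    -- Differentiation under the integral: the t-derivative of the kernel is e^{-rt}, dominated on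
    -- ]t/2, ∞[ by the integrable e^{-rt/2}.
    refine HasDerivAt.const_add B (hasDerivAt_integral_of_dominated_loc_of_deriv_le
      (s := Ioi (t / 2)) (bound := fun r => Real.exp (-r * (t / 2)))
      (F' := fun t r => Real.exp (-r * t)) (Ioi_mem_nhds (by linarith))
      (Eventually.of_forall fun s => Measurable.aestronglyMeasurable
        (by unfold bernsteinKernel; fun_prop))
      (hν.integrable_bernsteinKernel ht.le) (by fun_prop) ?_ (hν.integrable_exp (by linarith)) ?_).2
    · filter_upwards [ae_restrict_mem measurableSet_Ioi] with r hr s hs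
      rw [Real.norm_of_nonneg (Real.exp_nonneg _), Real.exp_le_exp]
      have hr0 : (0:ℝ) < r := hr
      have hs0 : t / 2 < s := hs
      nlinarith [mul_lt_mul_of_pos_left hs0 hr0]
    · filter_upwards [ae_restrict_mem measurableSet_Ioi] with r hr s hs
      have hr0 : r ≠ 0 := (mem_Ioi.1 hr).ne'
      have h1 : HasDerivAt (fun s : ℝ => -r * s) (-r) s := by
        simpa using (hasDerivAt_id s).const_mul (-r)
      have h2 : HasDerivAt (fun s => bernsteinKernel s r) (-(Real.exp (-r * s) * -r) / r) s :=
        (h1.exp.const_sub 1).div_const r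
      exact h2.congr_deriv (by field_simp)
  refine ⟨fun t ht => ?_, fun t ht => ?_, fun t ht =>
    (hderiv t ht).differentiableAt.differentiableWithinAt, ?_⟩
  · refine continuousWithinAt_const.add (continuousWithinAt_of_dominated
      (bound := fun r => (1 + (t + 1)) * (1 / (1 + r))) ?_ ?_ (hν.integrable_inv.const_mul _) ?_)
    · exact Eventually.of_forall fun s => Measurable.aestronglyMeasurable
        (by unfold bernsteinKernel; fun_prop)
    · filter_upwards [self_mem_nhdsWithin,
        mem_nhdsWithin_of_mem_nhds (Iio_mem_nhds (lt_add_one t))] with s hs hst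
      filter_upwards [ae_restrict_mem measurableSet_Ioi] with r hr
      have hr0 : (0:ℝ) < r := hr
      have hst' : s < t + 1 := hst
      rw [Real.norm_of_nonneg (bernsteinKernel_nonneg hs hr)]
      refine (bernsteinKernel_le hr).trans ?_
      gcongr
    · refine ae_of_all _ fun r => Continuous.continuousWithinAt ?_
      unfold bernsteinKernel
      fun_prop
  · exact add_nonneg hB (setIntegral_nonneg measurableSet_Ioi fun r hr =>
      bernsteinKernel_nonneg ht hr)
  · refine hν.isCompletelyMonotonic_mgf.congr fun t ht => ?_
    rw [(hderiv t ht).deriv, ProbabilityTheory.mgf]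
    refine integral_congr_ae (ae_of_all _ fun r => ?_)
    simp only
    ring_nf

lemma integrable_prod_bernsteinKernel_mul_exp (hν : IsSpectralMeasure ν) {x : ℝ} (hx : 0 < x) :
    Integrable (Function.uncurry fun t r => bernsteinKernel t r * Real.exp (-x * t))
      ((volume.restrict (Ioi (0 : ℝ))).prod (ν.restrict (Ioi 0))) := by
  -- Local finiteness makes ν σ-finite, as product measures require. The factor 1 + t is then
  -- absorbed by half of the exponential decay.
  have := hν.1
  obtain ⟨C, hC, h⟩ := exists_one_add_le_exp (half_pos hx)
  have hbound := ((integrableOn_exp_neg_mul (half_pos hx)).const_mul C).mul_prod hν.integrable_inv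
  refine hbound.mono' (Measurable.aestronglyMeasurable
    (by unfold bernsteinKernel Function.uncurry; fun_prop)) ?_
  rw [Measure.prod_restrict]
  filter_upwards [ae_restrict_mem (measurableSet_Ioi.prod measurableSet_Ioi)] with z hz
  have ht : (0:ℝ) < z.1 := hz.1
  have hr : (0:ℝ) < z.2 := hz.2
  have h0 := bernsteinKernel_nonneg ht.le hr
  simp only [Function.uncurry_def]
  rw [Real.norm_of_nonneg (by positivity)]
  calc bernsteinKernel z.1 z.2 * Real.exp (-x * z.1)
      ≤ ((C * Real.exp (x / 2 * z.1)) * (1 / (1 + z.2))) * Real.exp (-x * z.1) := by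
        gcongr
        refine (bernsteinKernel_le hr).trans ?_
        gcongr
        exact h _ ht.le
    _ = (C * Real.exp (-(x / 2) * z.1)) * (1 / (1 + z.2)) := by
        rw [show -(x / 2) * z.1 = x / 2 * z.1 + -x * z.1 by ring, Real.exp_add]
        ring

/-- By Fubini and the kernel transform 1/(x(x + r)); this identifies the wave number on the
half-line as a complete Bernstein function. -/
lemma sq_mul_laplace_bernstein (hν : IsSpectralMeasure ν) (B : ℝ) {x : ℝ} (hx : 0 < x) :
    (x : ℂ) ^ 2 * laplace (fun t => B + ∫ r in Ioi (0 : ℝ), bernsteinKernel t r ∂ν) x =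
      ((B * x + x * ∫ r in Ioi (0 : ℝ), 1 / (x + r) ∂ν : ℝ) : ℂ) := by
  have := hν.1
  have hint := hν.integrable_prod_bernsteinKernel_mul_exp hx
  have hswap : ∫ t in Ioi (0 : ℝ), ∫ r in Ioi (0 : ℝ), bernsteinKernel t r * Real.exp (-x * t) ∂ν =
      x⁻¹ * ∫ r in Ioi (0 : ℝ), 1 / (x + r) ∂ν := by
    rw [integral_integral_swap hint, ← integral_const_mul]
    exact setIntegral_congr_fun measurableSet_Ioi fun r hr =>
      integral_bernsteinKernel_mul_exp hx hr
  have hB : ∫ t in Ioi (0 : ℝ), B * Real.exp (-x * t) = B * x⁻¹ := by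
    rw [integral_const_mul, integral_exp_mul_Ioi (by linarith)]
    simp [neg_div_neg_eq]
  have hreal : laplace (fun t => B + ∫ r in Ioi (0 : ℝ), bernsteinKernel t r ∂ν) x =
      ((B * x⁻¹ + x⁻¹ * ∫ r in Ioi (0 : ℝ), 1 / (x + r) ∂ν : ℝ) : ℂ) := by
    have hleft : IntegrableOn
        (fun t => ∫ r in Ioi (0 : ℝ), bernsteinKernel t r * Real.exp (-x * t) ∂ν) (Ioi 0) :=
      hint.integral_prod_left
    rw [← hB, ← hswap, ← integral_add ((integrableOn_exp_neg_mul hx).const_mul B) hleft, laplace, ← integral_complex_ofReal]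
    refine integral_congr_ae (ae_of_all _ fun t => ?_)
    simp only
    rw [integral_mul_const]
    push_cast
    ring
  rw [hreal]
  have hx' : (x : ℂ) ≠ 0 := by exact_mod_cast hx.ne'
  push_cast
  field_simp

end IsSpectralMeasure

lemma dispersionAttenuation_ofReal (ν : Measure ℝ) (x : ℝ) :
    dispersionAttenuation ν x = ((x * ∫ r in Ioi (0 : ℝ), 1 / (x + r) ∂ν : ℝ) : ℂ) := by
  rw [dispersionAttenuation, Complex.ofReal_mul, ← integral_complex_ofReal]
  push_cast
  rfl

end Viscoelastic

end

theorem mainTheorem1 (ρ : ℝ) (hρ : 0 < ρ) (G : ℝ → ℝ) (hG : Viscoelastic.IsLICM G)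
    (Ginf : ℝ) (hlim : Tendsto G atTop (𝓝 Ginf)) (hpos : 0 < Ginf) :
    -- on the positive half-line the wave number is a (real-valued) complete Bernstein function
    (∀ x : ℝ, 0 < x → (Viscoelastic.waveNumber ρ G (x : ℂ)).im = 0) ∧
    Viscoelastic.IsCompleteBernstein (fun x : ℝ => (Viscoelastic.waveNumber ρ G (x : ℂ)).re) ∧
    -- it vanishes at the origin, as a limit from the right half-plane
    Tendsto (Viscoelastic.waveNumber ρ G) (𝓝[{p : ℂ | 0 < p.re}] 0) (𝓝 0) ∧
    -- integral representation in the right half-plane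
    ∃ (B : ℝ) (ν : Measure ℝ), 0 ≤ B ∧ Viscoelastic.IsSpectralMeasure ν ∧
      ∀ p : ℂ, 0 < p.re →
        Viscoelastic.waveNumber ρ G p = (B : ℂ) * p + Viscoelastic.dispersionAttenuation ν p := by
  obtain ⟨B, ν, hB, hν, h⟩ := hG.exists_waveNumber_eq hlim hpos ρ
  have hreal : ∀ x : ℝ, 0 < x → Viscoelastic.waveNumber ρ G x =
      ((B * x + x * ∫ r in Ioi (0 : ℝ), 1 / (x + r) ∂ν : ℝ) : ℂ) := by
    intro x hx
    rw [h x (by simpa using hx), Viscoelastic.dispersionAttenuation_ofReal]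
    push_cast
    rfl
  -- The Bernstein function is B + ∫ (1 - e^{-rt})/r ν(dr), with the same B and ν as in the
  -- representation.
  refine ⟨fun x hx => ?_, ⟨_, hν.isBernstein hB, fun x hx => ?_⟩,
    hG.tendsto_waveNumber hlim hpos ρ, B, ν, hB, hν, h⟩
  · rw [hreal x hx, Complex.ofReal_im]
  · simp only [hν.sq_mul_laplace_bernstein B hx, hreal x hx, Complex.ofReal_re]
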